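/- Let $(X,Y)$ be a random pair with values in $\mathbb{R}^d\times\mathbb{R}$ and let $(X_i,Y_i)$, $i\ge 1$, be i.i.d. copies of it, independent of $(X,Y)$; sensor $i$ holds $(X_i,Y_i)$. For each $i$ let $\{Z_{i,\theta}\}_{\theta\in[0,1]}$ be a family of $\{0,1\}$-valued random variables with $\mathbf{P}\{Z_{i,\theta}=1\}=\theta$, of the form $Z_{i,\theta}=z_i(\theta,\xi_i)$ with $z_i$ jointly measurable, where the random elements $\xi_1,\xi_2,\dots$ (the private randomness of the sensors) are independent of one another and of all the data $(X,Y),(X_1,Y_1),(X_2,Y_2),\dots$. Let $(c_n)_{n\ge1}$ be a sequence of real numbers and $(r_n)_{n\ge1}$ a sequence of real numbers that are positive for all large $n$. With $B_r(u)=\{v\in\mathbb{R}^d:\|v-u\|_2\le r\}$, put, for $1\le i\le n$ and $x\in\mathbb{R}^d$, $$\delta_{ni}(x)=\begin{cases} Z_{i,\,Y_i/(2c_n)+1/2}, & x\in B_{r_n}(X_i)\text{ and }|Y_i|\le c_n,\\ Z_{i,1/2}, & x\in B_{r_n}(X_i)\text{ and }|Y_i|>c_n,\\ \text{abstain}, &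 \text{otherwise},\end{cases}$$ and let the fusion center estimate $$\hat\eta_n(x)=2c_n\left(\frac{\sum_{i=1}^n\delta_{ni}(x)1_{\{\delta_{ni}(x)\ne\text{abstain}\}}}{\sum_{i=1}^n 1_{\{\delta_{ni}(x)\ne\text{abstain}\}}}-\frac12\right),$$ where the quotient is given an arbitrary fixed real value $q$ if all sensors abstain (for example $q=0$, or $q=1/2$). Let $D_n=\{(X_i,Y_i)\}_{i=1}^n$, $L_n=\mathbf{E}\{|\hat\eta_n(X)-Y|^2\mid D_n\}$ and $L^\star=\inf_g\mathbf{E}\{|g(X)-Y|^2\}$, the infimum over all measurable $g:\mathbb{R}^d\to\mathbb{R}$. Suppose that the distribution of $X$ has compact support and that $\mathbf{E}\{Y^2\}<\infty$. If, as $n\to\infty$, $c_n\to\infty$, $r_n\to0$ and $\dfrac{c_n^2}{n\,(r_n)^d}\to0$, then $|\hat\eta_n(X)-Y|^2$ is integrable for every $n$ and $\mathbf{E}\{L_n\}\to L^\star$. -/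

import Mathlib

open MeasureTheory ProbabilityTheory Filter Topology

noncomputable section

open Classical in
/-- The response of a sensor holding the training datum `(xi, yi)` to the query `x`.
The value `none` means that the sensor abstains; `some b` means that it votes and sends the bit `b`
(`true` is 1 and `false` is 0). `Z θ` is the outcome of the private coin of the sensor with
parameter `θ`. -/
def sensorResponse {d : ℕ} (c r : ℝ) (Z : ℝ → Bool) (xi : EuclideanSpace ℝ (Fin d)) (yi : ℝ)
    (x : EuclideanSpace ℝ (Fin d)) : Option Bool :=
  if x ∈ Metric.closedBall xi r then
    if |yi| ≤ c then some (Z (1 / (2 * c) * yi + 1 / 2)) else some (Z (1 / 2))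
  else none

/-- The number of ones sent by the voting sensors. -/
def sumOfVotes {n : ℕ} (δ : Fin n → Option Bool) : ℝ :=
  ∑ i, if δ i = some true then 1 else 0

/-- The number of sensors that do not abstain. -/
def numberOfVotes {n : ℕ} (δ : Fin n → Option Bool) : ℝ :=
  ∑ i, if δ i ≠ none then 1 else 0

/-- The average vote; `q` is the value given to the quotient `0 / 0` when all sensors abstain. -/
def averageVote {n : ℕ} (q : ℝ) (δ : Fin n → Option Bool) : ℝ :=
  if numberOfVotes δ = 0 then q else sumOfVotes δ / numberOfVotes δ

/-- The fusion rule: shift and rescale the average vote. -/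
def fusionRule {n : ℕ} (c q : ℝ) (δ : Fin n → Option Bool) : ℝ :=
  2 * c * (averageVote q δ - 1 / 2)

/-- The estimate `η̂ₙ(x)` of the network made of the first `n` sensors. -/
def networkEstimate {Ω : Type*} {d : ℕ} (c r : ℕ → ℝ) (q : ℝ)
    (Xs : ℕ → Ω → EuclideanSpace ℝ (Fin d)) (Ys : ℕ → Ω → ℝ) (Z : ℕ → ℝ → Ω → Bool)
    (n : ℕ) (x : EuclideanSpace ℝ (Fin d)) (ω : Ω) : ℝ :=
  fusionRule (c n) q fun i : Fin n =>
    sensorResponse (c n) (r n) (fun θ => Z i θ ω) (Xs i ω) (Ys i ω) x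

/-- The sigma-algebra generated by the training data of the first `n` sensors. -/
abbrev trainingSigma {Ω : Type*} {d : ℕ}
    (Xs : ℕ → Ω → EuclideanSpace ℝ (Fin d)) (Ys : ℕ → Ω → ℝ) (n : ℕ) : MeasurableSpace Ω :=
  MeasurableSpace.comap (fun ω (i : Fin n) => (Xs i ω, Ys i ω)) inferInstance

/-- The conditional risk `Lₙ = E{|η̂ₙ(X) - Y|² | Dₙ}`. -/
def conditionalRisk {Ω : Type*} [MeasurableSpace Ω] (μ : Measure Ω) {d : ℕ} (c r : ℕ → ℝ) (q : ℝ)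
    (X : Ω → EuclideanSpace ℝ (Fin d)) (Y : Ω → ℝ)
    (Xs : ℕ → Ω → EuclideanSpace ℝ (Fin d)) (Ys : ℕ → Ω → ℝ) (Z : ℕ → ℝ → Ω → Bool)
    (n : ℕ) : Ω → ℝ :=
  μ[fun ω => |networkEstimate c r q Xs Ys Z n (X ω) ω - Y ω| ^ 2 | trainingSigma Xs Ys n]

/-- The minimal risk `L⋆ = inf_g E{|g(X) - Y|²}`, over the measurable `g` with finite risk. -/
def minimalRisk {Ω : Type*} [MeasurableSpace Ω] (μ : Measure Ω) {d : ℕ}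
    (X : Ω → EuclideanSpace ℝ (Fin d)) (Y : Ω → ℝ) : ℝ :=
  sInf {R : ℝ | ∃ g : EuclideanSpace ℝ (Fin d) → ℝ, Measurable g ∧
    Integrable (fun ω => |g (X ω) - Y ω| ^ 2) μ ∧ R = ∫ ω, |g (X ω) - Y ω| ^ 2 ∂μ}

end

/-! Let `π` be the law of `X` and `η` the regression function. The estimate tends to `η(X)` in L²;
then the L² norm of the estimate minus `Y` tends to that of `η(X) - Y`, whose square is the minimal
risk. The error splits through the local average of the truncated label over the ball `B(x, r)`.

Variance. A vote with parameter `y/(2c) + 1/2`, once shifted and rescaled by `2c`, has mean `y`, and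
the fair coin decodes to `0`; so the network estimates that local average without seeing the labels.
For a fixed query `x` the average vote is a ratio of sums whose denominator has mean `nπ(B(x, r))`,
and its mean squared deviation is `O(1/(nπ(B(x, r))))` (`lintegral_ratio_sub_sq_le`). The rescaling
costs `4c²`. Cutting a bounded set into cells of diameter at most `r` gives `∫ 1/π(B(x, r)) π(dx) =
O(r^{-d})`, for every law on that set. The total is `O(c²/(n r^d))`.

Bias. The same covering bound on a ball of radius `r`, together with Jensen and Tonelli, shows that
local averaging is bounded on L² uniformly in `r` (`lintegral_localAverage_sq_le`). It converges on
compactly supported continuous functions, hence on L² by density. Truncation tends to the identity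
in L², and the label has the same local averages as `η`. -/

/-! ### Covering bounds for the reciprocal measure of balls -/

/-- If `S` has diameter at most `r`, then `∫_S 1 / π(B(x, r)) π(dx) ≤ 1`. -/
lemma setLIntegral_inv_measure_closedBall_le_one {E : Type*} [PseudoMetricSpace E]
    [MeasurableSpace E] (π : Measure E) {r : ℝ} {S : Set E}
    (hS : ∀ x ∈ S, ∀ y ∈ S, dist y x ≤ r) (hSm : MeasurableSet S) :
    ∫⁻ x in S, (π (Metric.closedBall x r))⁻¹ ∂π ≤ 1 := by
  calc ∫⁻ x in S, (π (Metric.closedBall x r))⁻¹ ∂π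
      ≤ ∫⁻ _ in S, (π S)⁻¹ ∂π := by
        refine setLIntegral_mono' hSm fun x hx => ?_
        -- The ball of radius `r` around any point of `S` contains `S`.
        exact ENNReal.inv_le_inv.2 (measure_mono fun y hy => hS x hx y hy)
    _ = (π S)⁻¹ * π S := by rw [setLIntegral_const]
    _ ≤ 1 := ENNReal.inv_mul_le_one _

lemma EuclideanSpace.dist_le_sum {d : ℕ} (x y : EuclideanSpace ℝ (Fin d)) :
    dist x y ≤ ∑ i, |x i - y i| := by
  rw [EuclideanSpace.dist_eq]
  refine Real.sqrt_le_iff.2 ⟨Finset.sum_nonneg fun _ _ => abs_nonneg _, ?_⟩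
  simp only [Real.dist_eq]
  exact Finset.sum_sq_le_sq_sum_of_nonneg fun _ _ => abs_nonneg _

/-- Integral over a cube of side `2 R` of the reciprocal of the measure of the ball of radius `r`:
it is at most the number of cells of side `r / (d + 1)` that the cube meets. -/
lemma setLIntegral_cube_inv_measure_closedBall_le {d : ℕ}
    (π : Measure (EuclideanSpace ℝ (Fin d))) {r R : ℝ} (hr : 0 < r) (hR : 0 ≤ R)
    (x₀ : EuclideanSpace ℝ (Fin d)) :
    ∫⁻ x in {x | ∀ i, |x i - x₀ i| ≤ R}, (π (Metric.closedBall x r))⁻¹ ∂π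
      ≤ ENNReal.ofReal ((2 * R * ((d + 1) / r) + 2) ^ d) := by
  -- A cell has side `1/s = r/(d + 1)`, so its ℓ¹ diameter is at most `d r/(d + 1) ≤ r`; `d + 1`
  -- instead of `d` keeps `s` positive in dimension zero.
  set s : ℝ := (d + 1) / r with hs
  have hs0 : 0 < s := by positivity
  let cell : (Fin d → ℤ) → Set (EuclideanSpace ℝ (Fin d)) := fun k => {x | ∀ i, ⌊s * x i⌋ = k i}
  let T : Finset (Fin d → ℤ) :=
    Fintype.piFinset fun i => Finset.Icc ⌊s * (x₀ i - R)⌋ ⌊s * (x₀ i + R)⌋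
  have hcell (k) : ∫⁻ x in cell k, (π (Metric.closedBall x r))⁻¹ ∂π ≤ 1 := by
    refine setLIntegral_inv_measure_closedBall_le_one π (fun x hx y hy => ?_) ?_
    · refine (EuclideanSpace.dist_le_sum y x).trans ?_
      have h (i : Fin d) : |y i - x i| ≤ 1 / s := by
        have h1 := (Int.abs_sub_lt_one_of_floor_eq_floor ((hy i).trans (hx i).symm)).le
        rw [← mul_sub, abs_mul, abs_of_pos hs0] at h1
        rw [le_div_iff₀ hs0]; linarith
      refine (Finset.sum_le_sum fun i _ => h i).trans ?_
      rw [Finset.sum_const, Finset.card_univ, Fintype.card_fin, nsmul_eq_mul, hs, one_div_div,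
        mul_div_assoc', div_le_iff₀ (by positivity)]
      nlinarith
    · have : cell k = ⋂ i, (fun x : EuclideanSpace ℝ (Fin d) => ⌊s * x i⌋) ⁻¹' {k i} := by
        ext x; simp [cell]
      rw [this]
      refine MeasurableSet.iInter fun i => ?_
      have : Measurable fun x : EuclideanSpace ℝ (Fin d) => ⌊s * x i⌋ :=
        Int.measurable_floor.comp (by fun_prop)
      exact this (measurableSet_singleton _)
  have hsub : {x : EuclideanSpace ℝ (Fin d) | ∀ i, |x i - x₀ i| ≤ R} ⊆ ⋃ k ∈ T, cell k := by
    intro x hx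
    simp only [Set.mem_iUnion]
    refine ⟨fun i => ⌊s * x i⌋, ?_, fun i => rfl⟩
    rw [Fintype.mem_piFinset]
    intro i
    have := abs_le.1 (hx i)
    exact Finset.mem_Icc.2 ⟨Int.floor_le_floor (by nlinarith), Int.floor_le_floor (by nlinarith)⟩
  -- Between `⌊a⌋` and `⌊b⌋` inclusive there are at most `b - a + 2` integers; here `b - a = 2Rs`.
  have hcard : (T.card : ℝ) ≤ (2 * R * s + 2) ^ d := by
    rw [Fintype.card_piFinset]
    push_cast
    refine (Finset.prod_le_prod (g := fun _ => 2 * R * s + 2) (fun i _ => Nat.cast_nonneg _)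
      fun i _ => ?_).trans (by simp)
    rw [Int.card_Icc]
    have h1 := Int.floor_le (s * (x₀ i + R))
    have h2 := Int.lt_floor_add_one (s * (x₀ i - R))
    have h3 : (((⌊s * (x₀ i + R)⌋ + 1 - ⌊s * (x₀ i - R)⌋).toNat : ℤ) : ℝ)
        ≤ 2 * R * s + 2 := by
      rw [Int.toNat_of_nonneg]
      · push_cast; linarith
      · have : ⌊s * (x₀ i - R)⌋ ≤ ⌊s * (x₀ i + R)⌋ := Int.floor_le_floor (by nlinarith)
        linarith
    exact_mod_cast h3
  calc _ ≤ ∫⁻ x in ⋃ k ∈ T, cell k, (π (Metric.closedBall x r))⁻¹ ∂π := lintegral_mono_set hsub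
    _ ≤ ∑ k ∈ T, ∫⁻ x in cell k, (π (Metric.closedBall x r))⁻¹ ∂π := by
      have := lintegral_iUnion_le (μ := π) (fun k : T => cell k)
        (fun x => (π (Metric.closedBall x r))⁻¹)
      rw [tsum_fintype, Finset.sum_coe_sort T
        (fun k => ∫⁻ x in cell k, (π (Metric.closedBall x r))⁻¹ ∂π)] at this
      rwa [Set.iUnion_subtype] at this
    _ ≤ ∑ k ∈ T, 1 := Finset.sum_le_sum fun k _ => hcell k
    _ = ENNReal.ofReal T.card := by simp
    _ ≤ _ := ENNReal.ofReal_le_ofReal hcard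

lemma closedBall_subset_cube {d : ℕ} (x₀ : EuclideanSpace ℝ (Fin d)) (R : ℝ) :
    Metric.closedBall x₀ R ⊆ {x | ∀ i, |x i - x₀ i| ≤ R} := by
  intro x hx i
  have := PiLp.norm_apply_le (x - x₀) i
  rw [Metric.mem_closedBall, dist_eq_norm] at hx
  simpa using this.trans hx

lemma setLIntegral_closedBall_inv_measure_closedBall_le {d : ℕ}
    (π : Measure (EuclideanSpace ℝ (Fin d))) {r R : ℝ} (hr : 0 < r) (hR : 0 ≤ R)
    (x₀ : EuclideanSpace ℝ (Fin d)) :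
    ∫⁻ x in Metric.closedBall x₀ R, (π (Metric.closedBall x r))⁻¹ ∂π
      ≤ ENNReal.ofReal ((2 * R * ((d + 1) / r) + 2) ^ d) :=
  (lintegral_mono_set (closedBall_subset_cube x₀ R)).trans
    (setLIntegral_cube_inv_measure_closedBall_le π hr hR x₀)

/-- Covering bound for a measure with bounded support. -/
lemma lintegral_inv_measure_closedBall_le {d : ℕ}
    (π : Measure (EuclideanSpace ℝ (Fin d))) {r R : ℝ} (hr : 0 < r) (hr1 : r ≤ 1) (hR : 0 ≤ R)
    (hπ : ∀ᵐ x ∂π, x ∈ Metric.closedBall 0 R) :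
    ∫⁻ x, (π (Metric.closedBall x r))⁻¹ ∂π
      ≤ ENNReal.ofReal ((2 * R * (d + 1) + 2) ^ d / r ^ d) := by
  have h := setLIntegral_closedBall_inv_measure_closedBall_le π hr hR 0
  rw [Measure.restrict_eq_self_of_ae_mem hπ] at h
  refine h.trans (ENNReal.ofReal_le_ofReal ?_)
  rw [← div_pow]
  refine pow_le_pow_left₀ (by positivity) ?_ _
  -- Since `r ≤ 1`, the additive `2` is at most `2 / r`.
  rw [le_div_iff₀ hr, add_mul]
  have : 2 * R * ((d + 1) / r) * r = 2 * R * (d + 1) := by field_simp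
  linarith

/-- Local version: the bound does not depend on the radius. -/
lemma setLIntegral_closedBall_inv_measure_closedBall_le_const {d : ℕ}
    (π : Measure (EuclideanSpace ℝ (Fin d))) {r : ℝ} (hr : 0 < r)
    (x₀ : EuclideanSpace ℝ (Fin d)) :
    ∫⁻ x in Metric.closedBall x₀ r, (π (Metric.closedBall x r))⁻¹ ∂π
      ≤ ENNReal.ofReal ((2 * (d + 1) + 2) ^ d) := by
  have h := setLIntegral_closedBall_inv_measure_closedBall_le π hr hr.le x₀
  rwa [show 2 * r * ((d + 1) / r) = 2 * ((d : ℝ) + 1) by field_simp] at h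

/-! ### Squares of L² norms and Jensen's inequality -/

lemma eLpNorm_two_sq {α ε : Type*} [MeasurableSpace α] [ENorm ε] (f : α → ε) (μ : Measure α) :
    eLpNorm f 2 μ ^ 2 = ∫⁻ x, ‖f x‖ₑ ^ 2 ∂μ := by
  have := eLpNorm_nnreal_pow_eq_lintegral (μ := μ) (f := f) (p := 2) two_ne_zero
  simpa using this

lemma eLpNorm_two_le_of_lintegral_le {α β : Type*} [MeasurableSpace α] [MeasurableSpace β]
    {f : α → ℝ} {g : β → ℝ} {μ : Measure α} {ν : Measure β} {C : ENNReal}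
    (h : ∫⁻ x, ‖f x‖ₑ ^ 2 ∂μ ≤ C * ∫⁻ y, ‖g y‖ₑ ^ 2 ∂ν) :
    eLpNorm f 2 μ ≤ C ^ (1 / 2 : ℝ) * eLpNorm g 2 ν := by
  rw [← ENNReal.pow_le_pow_left_iff two_ne_zero, mul_pow, eLpNorm_two_sq, eLpNorm_two_sq,
    ← ENNReal.rpow_mul_natCast]
  simpa using h

/-- Jensen's inequality for the square of a set average. -/
lemma enorm_setAverage_sq_le {α : Type*} [MeasurableSpace α] {ν : Measure α} [IsFiniteMeasure ν]
    {f : α → ℝ} (hf : AEStronglyMeasurable f ν) (S : Set α) :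
    ‖⨍ z in S, f z ∂ν‖ₑ ^ 2 ≤ (ν S)⁻¹ * ∫⁻ z in S, ‖f z‖ₑ ^ 2 ∂ν := by
  rcases eq_or_ne (ν S) 0 with h0 | h0
  · simp [Measure.restrict_eq_zero.2 h0]
  have htop : ν S ≠ ⊤ := measure_ne_top ν S
  -- Cauchy–Schwarz against the constant `1` on `S`.
  have h1 : (∫⁻ z in S, ‖f z‖ₑ ∂ν) ^ 2 ≤ (∫⁻ z in S, ‖f z‖ₑ ^ 2 ∂ν) * ν S := by
    have h := eLpNorm_le_eLpNorm_mul_rpow_measure_univ (p := 1) (q := 2) (μ := ν.restrict S)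
      (by norm_num) hf.restrict
    rw [eLpNorm_one_eq_lintegral_enorm, ← ENNReal.pow_le_pow_left_iff two_ne_zero, mul_pow,
      eLpNorm_two_sq, ← ENNReal.rpow_mul_natCast] at h
    norm_num at h
    exact h
  rw [setAverage_eq, enorm_smul, mul_pow]
  have h2 : ‖(ν.real S)⁻¹‖ₑ = (ν S)⁻¹ := by
    rw [Measure.real, ← ENNReal.toReal_inv, Real.enorm_eq_ofReal ENNReal.toReal_nonneg,
      ENNReal.ofReal_toReal (by simp [h0])]
  rw [h2]
  calc (ν S)⁻¹ ^ 2 * ‖∫ z in S, f z ∂ν‖ₑ ^ 2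
      ≤ (ν S)⁻¹ ^ 2 * ((∫⁻ z in S, ‖f z‖ₑ ^ 2 ∂ν) * ν S) := by
        gcongr
        exact (pow_le_pow_left' (enorm_integral_le_lintegral_enorm f) 2).trans h1
    _ = (ν S)⁻¹ * ((ν S)⁻¹ * ν S) * ∫⁻ z in S, ‖f z‖ₑ ^ 2 ∂ν := by ring
    _ ≤ (ν S)⁻¹ * ∫⁻ z in S, ‖f z‖ₑ ^ 2 ∂ν := by
        rw [ENNReal.inv_mul_cancel h0 htop, mul_one]

/-! ### Local averages and their L² convergence -/

section LocalAverage

variable {d : ℕ}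

/-- The average of `f` over the points whose first coordinate is within distance `r` of `x`. -/
noncomputable def localAverage (ν : Measure (EuclideanSpace ℝ (Fin d) × ℝ)) (r : ℝ)
    (f : EuclideanSpace ℝ (Fin d) × ℝ → ℝ) (x : EuclideanSpace ℝ (Fin d)) : ℝ :=
  ⨍ z in Prod.fst ⁻¹' Metric.closedBall x r, f z ∂ν

variable {ν : Measure (EuclideanSpace ℝ (Fin d) × ℝ)}

lemma measurableSet_dist_le (r : ℝ) :
    MeasurableSet {p : EuclideanSpace ℝ (Fin d) × EuclideanSpace ℝ (Fin d) | dist p.2 p.1 ≤ r} :=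
  measurableSet_le (by fun_prop) measurable_const

lemma measurableSet_dist_fst_le (r : ℝ) :
    MeasurableSet {p : EuclideanSpace ℝ (Fin d) × (EuclideanSpace ℝ (Fin d) × ℝ) |
      dist p.2.1 p.1 ≤ r} :=
  measurableSet_le (by fun_prop) measurable_const

lemma measurable_measure_closedBall {π : Measure (EuclideanSpace ℝ (Fin d))} [SFinite π] (r : ℝ) :
    Measurable fun x => π (Metric.closedBall x r) :=
  measurable_measure_prodMk_left (ν := π) (measurableSet_dist_le r)

lemma fst_closedBall (x : EuclideanSpace ℝ (Fin d)) (r : ℝ) :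
    ν (Prod.fst ⁻¹' Metric.closedBall x r) = ν.fst (Metric.closedBall x r) :=
  (Measure.fst_apply Metric.isClosed_closedBall.measurableSet).symm

/-- Both the mass of the window and the integral over it are parametric integrals of functions
jointly measurable in the centre and the point. -/
lemma measurable_localAverage [IsFiniteMeasure ν]
    {f : EuclideanSpace ℝ (Fin d) × ℝ → ℝ} (hf : Measurable f) (r : ℝ) :
    Measurable (localAverage ν r f) := by
  have h1 : Measurable fun x => ν (Prod.fst ⁻¹' Metric.closedBall x r) :=
    measurable_measure_prodMk_left (ν := ν) (measurableSet_dist_fst_le r)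
  have h2 : StronglyMeasurable fun x => ∫ z, Set.indicator
      {p : EuclideanSpace ℝ (Fin d) × (EuclideanSpace ℝ (Fin d) × ℝ) | dist p.2.1 p.1 ≤ r}
      (fun p => f p.2) (x, z) ∂ν :=
    StronglyMeasurable.integral_prod_right'
      ((hf.comp measurable_snd).indicator (measurableSet_dist_fst_le r)).stronglyMeasurable
  have h3 : localAverage ν r f = fun x => (ν (Prod.fst ⁻¹' Metric.closedBall x r)).toReal⁻¹ *
      ∫ z, Set.indicator
      {p : EuclideanSpace ℝ (Fin d) × (EuclideanSpace ℝ (Fin d) × ℝ) | dist p.2.1 p.1 ≤ r}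
      (fun p => f p.2) (x, z) ∂ν := by
    funext x
    rw [localAverage, setAverage_eq, smul_eq_mul, ← integral_indicator
      (measurable_fst Metric.isClosed_closedBall.measurableSet)]
    rfl
  rw [h3]
  exact h1.ennreal_toReal.inv.mul h2.measurable

/-- Local averaging is bounded on `L²`, uniformly in the radius. -/
lemma lintegral_localAverage_sq_le [IsFiniteMeasure ν]
    {f : EuclideanSpace ℝ (Fin d) × ℝ → ℝ} (hf : Measurable f)
    {r : ℝ} (hr : 0 < r) :
    ∫⁻ x, ‖localAverage ν r f x‖ₑ ^ 2 ∂ν.fst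
      ≤ ENNReal.ofReal ((2 * (d + 1) + 2) ^ d) * ∫⁻ z, ‖f z‖ₑ ^ 2 ∂ν := by
  let A := {p : EuclideanSpace ℝ (Fin d) × (EuclideanSpace ℝ (Fin d) × ℝ) | dist p.2.1 p.1 ≤ r}
  have hA : MeasurableSet A := measurableSet_dist_fst_le r
  have hp : Measurable fun x => ν.fst (Metric.closedBall x r) := measurable_measure_closedBall r
  let G : EuclideanSpace ℝ (Fin d) → EuclideanSpace ℝ (Fin d) × ℝ → ENNReal := fun x z =>
    A.indicator (fun p => (ν.fst (Metric.closedBall p.1 r))⁻¹ * ‖f p.2‖ₑ ^ 2) (x, z)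
  have hG : Measurable (Function.uncurry G) := by
    refine Measurable.indicator ?_ hA
    exact (hp.comp measurable_fst).inv.mul ((hf.comp measurable_snd).enorm.pow_const 2)
  calc ∫⁻ x, ‖localAverage ν r f x‖ₑ ^ 2 ∂ν.fst
      ≤ ∫⁻ x, ∫⁻ z, G x z ∂ν ∂ν.fst := by
        refine lintegral_mono fun x => ?_
        refine (enorm_setAverage_sq_le hf.aestronglyMeasurable _).trans ?_
        rw [fst_closedBall, ← lintegral_const_mul _ (hf.enorm.pow_const 2), ← lintegral_indicator
          (measurable_fst Metric.isClosed_closedBall.measurableSet)]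
        rfl
    -- The relation `dist z.1 x ≤ r` is symmetric, so after the swap `x` runs over the ball of the
    -- same radius around `z.1`. There the covering bound depends on `d` only.
    _ = ∫⁻ z, ∫⁻ x, G x z ∂ν.fst ∂ν := lintegral_lintegral_swap hG.aemeasurable
    _ ≤ ∫⁻ z, ENNReal.ofReal ((2 * (d + 1) + 2) ^ d) * ‖f z‖ₑ ^ 2 ∂ν := by
        refine lintegral_mono fun z => ?_
        have : ∀ x, G x z = (Metric.closedBall z.1 r).indicator
            (fun x => (ν.fst (Metric.closedBall x r))⁻¹ * ‖f z‖ₑ ^ 2) x := by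
          intro x
          have : x ∈ Metric.closedBall z.1 r ↔ (x, z) ∈ A := by
            rw [Metric.mem_closedBall, dist_comm]; rfl
          by_cases h : (x, z) ∈ A
          · simp only [G, Set.indicator_of_mem h, Set.indicator_of_mem (this.2 h)]
          · simp only [G, Set.indicator_of_notMem h, Set.indicator_of_notMem (mt this.1 h)]
        simp_rw [this]
        rw [lintegral_indicator Metric.isClosed_closedBall.measurableSet,
          lintegral_mul_const (f := fun x => (ν.fst (Metric.closedBall x r))⁻¹) _ hp.inv]
        gcongr
        exact setLIntegral_closedBall_inv_measure_closedBall_le_const _ hr _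
    _ = _ := lintegral_const_mul _ (hf.enorm.pow_const 2)

lemma eLpNorm_localAverage_le [IsFiniteMeasure ν]
    {f : EuclideanSpace ℝ (Fin d) × ℝ → ℝ} (hf : Measurable f)
    {r : ℝ} (hr : 0 < r) :
    eLpNorm (localAverage ν r f) 2 ν.fst
      ≤ ENNReal.ofReal ((2 * (d + 1) + 2) ^ d) ^ (1 / 2 : ℝ) * eLpNorm f 2 ν :=
  eLpNorm_two_le_of_lintegral_le (lintegral_localAverage_sq_le hf hr)

lemma localAverage_sub {f g : EuclideanSpace ℝ (Fin d) × ℝ → ℝ} (hf : Integrable f ν)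
    (hg : Integrable g ν) (r : ℝ) (x : EuclideanSpace ℝ (Fin d)) :
    localAverage ν r (f - g) x = localAverage ν r f x - localAverage ν r g x := by
  simp only [localAverage, setAverage_eq, Pi.sub_apply, smul_eq_mul]
  rw [integral_sub hf.integrableOn hg.integrableOn, mul_sub]

/-- Almost every point lies in the support, where every neighbourhood has positive mass. -/
lemma ae_fst_closedBall_ne_zero [IsFiniteMeasure ν] {r : ℝ} (hr : 0 < r) :
    ∀ᵐ x ∂ν.fst, ν (Prod.fst ⁻¹' Metric.closedBall x r) ≠ 0 := by
  filter_upwards [Measure.support_mem_ae (μ := ν.fst)] with x hx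
  rw [fst_closedBall]
  exact ((Measure.mem_support_iff_forall x).1 hx _ (Metric.closedBall_mem_nhds x hr)).ne'

/-- Local averages of a uniformly continuous function are uniformly close to it. -/
lemma tendsto_eLpNorm_localAverage_sub_of_uniformContinuous [IsFiniteMeasure ν]
    {g : EuclideanSpace ℝ (Fin d) → ℝ}
    (hg : UniformContinuous g) (hgi : Integrable (fun z => g z.1) ν) {r : ℕ → ℝ}
    (hrpos : ∀ᶠ n in atTop, 0 < r n) (hr : Tendsto r atTop (𝓝 0)) :
    Tendsto (fun n => eLpNorm (fun x => localAverage ν (r n) (fun z => g z.1) x - g x) 2 ν.fst)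
      atTop (𝓝 0) := by
  have key : ∀ ε : ℝ, 0 < ε → ∀ᶠ n in atTop,
      eLpNorm (fun x => localAverage ν (r n) (fun z => g z.1) x - g x) 2 ν.fst
        ≤ ν.fst Set.univ ^ (1 / 2 : ℝ) * ENNReal.ofReal ε := by
    intro ε hε
    obtain ⟨δ, hδ, hgδ⟩ := Metric.uniformContinuous_iff.1 hg ε hε
    filter_upwards [hrpos, hr.eventually (gt_mem_nhds hδ)] with n hn hnδ
    have := eLpNorm_le_of_ae_bound (p := 2) (μ := ν.fst) (C := ε)
      (f := fun x => localAverage ν (r n) (fun z => g z.1) x - g x) ?_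
    · simpa using this
    filter_upwards [ae_fst_closedBall_ne_zero hn] with x hx
    have hS : MeasurableSet
        (Prod.fst ⁻¹' Metric.closedBall x (r n) : Set (EuclideanSpace ℝ (Fin d) × ℝ)) :=
      measurable_fst Metric.isClosed_closedBall.measurableSet
    -- An average of values in a closed convex set stays in it, provided the window has positive
    -- mass.
    have := (convex_closedBall (g x) ε).set_average_mem Metric.isClosed_closedBall
      hx (measure_ne_top _ _) (f := fun z => g z.1) ?_ hgi.integrableOn
    · rwa [Metric.mem_closedBall, dist_eq_norm] at this
    · filter_upwards [ae_restrict_mem hS] with z hz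
      exact (hgδ ((Metric.mem_closedBall.1 hz).trans_lt hnδ)).le
  rw [ENNReal.tendsto_nhds_zero]
  intro ε hε
  have hlim : Tendsto (fun t : ℝ => ν.fst Set.univ ^ (1 / 2 : ℝ) * ENNReal.ofReal t)
      (𝓝[>] 0) (𝓝 0) := by
    have := ENNReal.Tendsto.const_mul (a := ν.fst Set.univ ^ (1 / 2 : ℝ))
      (ENNReal.tendsto_ofReal
        (tendsto_id.mono_left nhdsWithin_le_nhds : Tendsto id (𝓝[>] (0 : ℝ)) (𝓝 0)))
      (Or.inr (ENNReal.rpow_ne_top_of_nonneg (by norm_num) (measure_ne_top _ _)))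
    simpa using this
  obtain ⟨t, ht, ht0⟩ := ((ENNReal.tendsto_nhds_zero.1 hlim ε hε).and self_mem_nhdsWithin).exists
  filter_upwards [key t ht0] with n hn using hn.trans ht

lemma eLpNorm_comp_fst {u : EuclideanSpace ℝ (Fin d) → ℝ} (hu : Measurable u) :
    eLpNorm (fun z => u z.1) 2 ν = eLpNorm u 2 ν.fst :=
  (eLpNorm_map_measure hu.aestronglyMeasurable measurable_fst.aemeasurable).symm

/-- `L²` convergence of local averages. -/
lemma tendsto_eLpNorm_localAverage_sub [IsFiniteMeasure ν]
    {u : EuclideanSpace ℝ (Fin d) → ℝ} (hu : Measurable u)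
    (hu2 : MemLp u 2 ν.fst) {r : ℕ → ℝ}
    (hrpos : ∀ᶠ n in atTop, 0 < r n) (hr : Tendsto r atTop (𝓝 0)) :
    Tendsto (fun n => eLpNorm (fun x => localAverage ν (r n) (fun z => u z.1) x - u x) 2 ν.fst)
      atTop (𝓝 0) := by
  set K : ENNReal := ENNReal.ofReal ((2 * (d + 1) + 2) ^ d) ^ (1 / 2 : ℝ)
  have hKtop : K ≠ ⊤ := ENNReal.rpow_ne_top_of_nonneg (by norm_num) ENNReal.ofReal_ne_top
  -- With `g` continuous of compact support and within `ε` of `u`, the three terms bound the average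
  -- of `u - g`, the error of averaging `g`, and `g - u`.
  have key : ∀ ε : ENNReal, ε ≠ 0 → ∀ᶠ n in atTop,
      eLpNorm (fun x => localAverage ν (r n) (fun z => u z.1) x - u x) 2 ν.fst
        ≤ K * ε + ε + ε := by
    intro ε hε
    obtain ⟨g, hgc, hgu, hgcont, hg2⟩ :=
      hu2.exists_hasCompactSupport_eLpNorm_sub_le (by norm_num) hε
    have hgi : Integrable (fun z => g z.1) ν :=
      (hg2.integrable (by norm_num)).comp_measurable measurable_fst
    have hui : Integrable (fun z => u z.1) ν :=
      (hu2.integrable (by norm_num)).comp_measurable measurable_fst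
    have hgunif : UniformContinuous g := hgc.uniformContinuous_of_continuous hgcont
    have h1 := ENNReal.tendsto_nhds_zero.1
      (tendsto_eLpNorm_localAverage_sub_of_uniformContinuous hgunif hgi hrpos hr) ε
      (pos_iff_ne_zero.2 hε)
    filter_upwards [h1, hrpos] with n hn hrn
    have hm1 : Measurable fun z : EuclideanSpace ℝ (Fin d) × ℝ => u z.1 := hu.comp measurable_fst
    have hm2 : Measurable fun z : EuclideanSpace ℝ (Fin d) × ℝ => g z.1 :=
      hgcont.measurable.comp measurable_fst
    have hdecomp : (fun x => localAverage ν (r n) (fun z => u z.1) x - u x)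
        = localAverage ν (r n) ((fun z => u z.1) - fun z => g z.1)
          + (fun x => localAverage ν (r n) (fun z => g z.1) x - g x) - (u - g) := by
      funext x
      simp only [Pi.add_apply, Pi.sub_apply, localAverage_sub hui hgi]
      ring
    have hM : Measurable (localAverage ν (r n) ((fun z => u z.1) - fun z => g z.1)) :=
      measurable_localAverage (hm1.sub hm2) _
    have hM' : Measurable (fun x => localAverage ν (r n) (fun z => g z.1) x - g x) :=
      (measurable_localAverage hm2 _).sub hgcont.measurable
    rw [hdecomp]
    refine (eLpNorm_sub_le (hM.add hM').aestronglyMeasurable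
      (hu.sub hgcont.measurable).aestronglyMeasurable (by norm_num)).trans ?_
    refine add_le_add ((eLpNorm_add_le hM.aestronglyMeasurable hM'.aestronglyMeasurable
      (by norm_num)).trans (add_le_add ?_ hn)) hgu
    refine (eLpNorm_localAverage_le (hm1.sub hm2) hrn).trans ?_
    gcongr
    have : ((fun z : EuclideanSpace ℝ (Fin d) × ℝ => u z.1) - fun z => g z.1)
      = fun z => (u - g) z.1 := rfl
    rw [this, eLpNorm_comp_fst (hu.sub hgcont.measurable)]
    exact hgu
  rw [ENNReal.tendsto_nhds_zero]
  intro ε hε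
  have hlim : Tendsto (fun t : ENNReal => K * t + t + t) (𝓝[>] 0) (𝓝 0) := by
    have h0 : Tendsto (fun t : ENNReal => t) (𝓝[>] 0) (𝓝 0) :=
      tendsto_id.mono_left nhdsWithin_le_nhds
    simpa using ((ENNReal.Tendsto.const_mul h0 (Or.inr hKtop)).add h0).add h0
  obtain ⟨t, ht, ht0⟩ := ((ENNReal.tendsto_nhds_zero.1 hlim ε hε).and self_mem_nhdsWithin).exists
  filter_upwards [key t (ne_of_gt ht0)] with n hn using hn.trans ht

/-- Local averages of an `L²`-convergent sequence converge to the regression function. -/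
lemma tendsto_eLpNorm_localAverage_seq_sub [IsFiniteMeasure ν]
    {u : EuclideanSpace ℝ (Fin d) → ℝ} (hu : Measurable u)
    (hu2 : MemLp u 2 ν.fst) {f : EuclideanSpace ℝ (Fin d) × ℝ → ℝ} (hf : Measurable f)
    (hf2 : MemLp f 2 ν)
    (hfu : ∀ B, MeasurableSet B →
      ∫ z in Prod.fst ⁻¹' B, f z ∂ν = ∫ z in Prod.fst ⁻¹' B, u z.1 ∂ν)
    {F : ℕ → EuclideanSpace ℝ (Fin d) × ℝ → ℝ} (hF : ∀ n, Measurable (F n))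
    (hF2 : ∀ n, MemLp (F n) 2 ν)
    (hFf : Tendsto (fun n => eLpNorm (F n - f) 2 ν) atTop (𝓝 0)) {r : ℕ → ℝ}
    (hrpos : ∀ᶠ n in atTop, 0 < r n) (hr : Tendsto r atTop (𝓝 0)) :
    Tendsto (fun n => eLpNorm (fun x => localAverage ν (r n) (F n) x - u x) 2 ν.fst)
      atTop (𝓝 0) := by
  set K : ENNReal := ENNReal.ofReal ((2 * (d + 1) + 2) ^ d) ^ (1 / 2 : ℝ)
  have hKtop : K ≠ ⊤ := ENNReal.rpow_ne_top_of_nonneg (by norm_num) ENNReal.ofReal_ne_top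
  have h0 := (ENNReal.Tendsto.const_mul hFf (Or.inr hKtop)).add
    (tendsto_eLpNorm_localAverage_sub hu hu2 hrpos hr)
  rw [mul_zero, add_zero] at h0
  refine tendsto_of_tendsto_of_tendsto_of_le_of_le' tendsto_const_nhds h0
    (Eventually.of_forall fun _ => zero_le) ?_
  filter_upwards [hrpos] with n hrn
  -- Windows are cylinders over the first coordinate, where `f` and `u` have equal integrals.
  have hfu' : ∀ x, localAverage ν (r n) f x = localAverage ν (r n) (fun z => u z.1) x := by
    intro x
    simp only [localAverage, setAverage_eq]
    rw [hfu _ Metric.isClosed_closedBall.measurableSet]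
  have hdecomp : (fun x => localAverage ν (r n) (F n) x - u x)
      = localAverage ν (r n) (F n - f)
        + (fun x => localAverage ν (r n) (fun z => u z.1) x - u x) := by
    funext x
    simp only [Pi.add_apply, ← hfu', localAverage_sub ((hF2 n).integrable (by norm_num))
      (hf2.integrable (by norm_num))]
    ring
  rw [hdecomp]
  refine (eLpNorm_add_le (measurable_localAverage ((hF n).sub hf) _).aestronglyMeasurable
    ((measurable_localAverage (hu.comp measurable_fst) _).sub hu).aestronglyMeasurable
    (by norm_num)).trans ?_
  exact add_le_add_left (eLpNorm_localAverage_le ((hF n).sub hf) hrn) _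

end LocalAverage

/-! ### Mean squared error of a ratio of sums -/

section Variance

variable {Ω : Type*} [MeasurableSpace Ω] {μ : Measure Ω} [IsProbabilityMeasure μ]

/-- The left side is the variance of the sum; variances add under pairwise independence, and each is
at most the second moment. -/
lemma integral_sum_sub_sq_le {n : ℕ} {U : Fin n → Ω → ℝ} (hU : ∀ i, Measurable (U i))
    (hU1 : ∀ i ω, |U i ω| ≤ 1) (hind : Pairwise fun i j => IndepFun (U i) (U j) μ) {e p : ℝ}
    (he : ∀ i, ∫ ω, U i ω ∂μ = e) (hp : ∀ i, ∫ ω, U i ω ^ 2 ∂μ ≤ p) :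
    ∫ ω, (∑ i, U i ω - n * e) ^ 2 ∂μ ≤ n * p := by
  have hL (i) : MemLp (U i) 2 μ :=
    MemLp.of_bound (hU i).aestronglyMeasurable 1 (Eventually.of_forall (hU1 i))
  have hsum : Measurable (∑ i, U i) := by
    rw [show ∑ i, U i = fun ω => ∑ i, U i ω from by ext; simp]
    exact Finset.measurable_fun_sum _ fun i _ => hU i
  have h1 := variance_eq_integral (μ := μ) hsum.aemeasurable
  have h2 : ∫ ω, (∑ i, U i) ω ∂μ = n * e := by
    simp only [Finset.sum_apply]
    rw [integral_finsetSum _ fun i _ => (hL i).integrable (by norm_num)]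
    simp [he]
  rw [h2] at h1
  simp only [Finset.sum_apply] at h1
  rw [← h1, IndepFun.variance_sum (fun i _ => hL i) (fun i _ j _ hij => hind hij)]
  refine (Finset.sum_le_sum (g := fun _ => p) fun i _ => ?_).trans (by simp)
  exact (variance_le_expectation_sq (hU i).aestronglyMeasurable).trans (hp i)

/-- If `N ≥ P/2`, dividing `S - mN` by `N` costs at most `4/P²` after squaring. Otherwise `|N - P| >
P/2`, and the crude bound `|q| + 1` on the error is paid for by the deviation of `N`; this case
contains `N = 0`. -/
lemma ratio_sub_sq_le {N S P m q : ℝ} (hP : 0 < P) (hS0 : 0 ≤ S) (hSN : S ≤ N)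
    (hm0 : 0 ≤ m) (hm1 : m ≤ 1) :
    ((if N = 0 then q else S / N) - m) ^ 2
      ≤ 4 / P ^ 2 * (S - m * N) ^ 2 + 4 * (|q| + 1) ^ 2 / P ^ 2 * (N - P) ^ 2 := by
  have hA : 0 ≤ 4 / P ^ 2 * (S - m * N) ^ 2 := by positivity
  have hB : 0 ≤ 4 * (|q| + 1) ^ 2 / P ^ 2 * (N - P) ^ 2 := by positivity
  rcases le_or_gt (P / 2) N with h | h
  · have hN : 0 < N := by linarith
    rw [if_neg hN.ne', show S / N - m = (S - m * N) / N by field_simp, div_pow]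
    refine le_trans ?_ (le_add_of_nonneg_right hB)
    rw [div_mul_eq_mul_div, div_le_div_iff₀ (by positivity) (by positivity)]
    have : P ^ 2 ≤ 4 * N ^ 2 := by nlinarith
    nlinarith [sq_nonneg (S - m * N)]
  · refine le_trans ?_ (le_add_of_nonneg_left hA)
    have h1 : (|q| + 1) ^ 2 ≤ 4 * (|q| + 1) ^ 2 / P ^ 2 * (N - P) ^ 2 := by
      rw [div_mul_eq_mul_div, le_div_iff₀ (by positivity)]
      have : P ^ 2 ≤ 4 * (N - P) ^ 2 := by nlinarith
      nlinarith [sq_nonneg (|q| + 1)]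
    refine le_trans (sq_le_sq.2 ?_) h1
    rw [abs_of_nonneg (a := |q| + 1) (by positivity)]
    split_ifs with h0
    · have := abs_sub q m
      rw [abs_of_nonneg hm0] at this
      linarith
    · have hN : 0 < N := lt_of_le_of_ne (hS0.trans hSN) (Ne.symm h0)
      have h2 : 0 ≤ S / N := by positivity
      have h3 : S / N ≤ 1 := (div_le_one hN).2 hSN
      rw [abs_le]
      constructor <;> linarith [abs_nonneg q]

/-- Mean squared deviation of a ratio of sums of pairwise independent variables from the ratio of
the expectations. -/
lemma lintegral_ratio_sub_sq_le {n : ℕ} (hn : n ≠ 0) {s v : Fin n → Ω → ℝ}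
    (hs : ∀ i, Measurable (s i)) (hv : ∀ i, Measurable (v i)) (hs0 : ∀ i ω, 0 ≤ s i ω)
    (hsv : ∀ i ω, s i ω ≤ v i ω) (hv1 : ∀ i ω, v i ω ≤ 1)
    (hind : Pairwise fun i j =>
      IndepFun (fun ω => (s i ω, v i ω)) (fun ω => (s j ω, v j ω)) μ)
    {p m : ℝ} (hp : 0 < p) (hm0 : 0 ≤ m) (hm1 : m ≤ 1) (hEv : ∀ i, ∫ ω, v i ω ∂μ = p)
    (hEs : ∀ i, ∫ ω, s i ω ∂μ = p * m) (q : ℝ) :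
    ∫⁻ ω, ‖(if ∑ i, v i ω = 0 then q else (∑ i, s i ω) / ∑ i, v i ω) - m‖ₑ ^ 2 ∂μ
      ≤ ENNReal.ofReal ((4 + 4 * (|q| + 1) ^ 2) / (n * p)) := by
  have hn0 : (0 : ℝ) < n := by positivity
  set P : ℝ := n * p with hPdef
  have hP : 0 < P := by positivity
  have hvi (i) : Integrable (v i) μ :=
    Integrable.of_bound (hv i).aestronglyMeasurable 1 (Eventually.of_forall fun ω => by
      rw [Real.norm_eq_abs, abs_le]; constructor <;> linarith [hs0 i ω, hsv i ω, hv1 i ω])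
  have hsi (i) : Integrable (s i) μ :=
    Integrable.of_bound (hs i).aestronglyMeasurable 1 (Eventually.of_forall fun ω => by
      rw [Real.norm_eq_abs, abs_le]; constructor <;> linarith [hs0 i ω, hsv i ω, hv1 i ω])
  have hbd : ∀ i ω, |s i ω - m * v i ω| ≤ v i ω := fun i ω => by
    have := hs0 i ω
    have := hsv i ω
    have : 0 ≤ v i ω := by linarith
    rw [abs_le]; constructor <;> nlinarith
  -- As `0 ≤ v ≤ 1`, `v² ≤ v`, so the second moments are at most `p`.
  have hV : ∫ ω, (∑ i, v i ω - P) ^ 2 ∂μ ≤ P := by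
    refine integral_sum_sub_sq_le hv
      (fun i ω => by rw [abs_le]; constructor <;> linarith [hs0 i ω, hsv i ω, hv1 i ω])
      (fun i j hij => (hind hij).comp measurable_snd measurable_snd) hEv fun i => ?_
    rw [← hEv i]
    refine integral_mono_of_nonneg (Eventually.of_forall fun ω => sq_nonneg _) (hvi i)
      (Eventually.of_forall fun ω => ?_)
    have := hs0 i ω
    have := hsv i ω
    have := hv1 i ω
    dsimp only
    nlinarith
  have hφ : Measurable fun z : ℝ × ℝ => z.1 - m * z.2 := by fun_prop
  -- The variables `s - m v` are centred because `E s = p m`, and their squares are dominated by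
  -- `v`.
  have hS : ∫ ω, (∑ i, (s i ω - m * v i ω) - n * 0) ^ 2 ∂μ ≤ P := by
    refine integral_sum_sub_sq_le (U := fun i ω => s i ω - m * v i ω)
      (fun i => (hs i).sub ((hv i).const_mul m))
      (fun i ω => (hbd i ω).trans (hv1 i ω)) (fun i j hij => (hind hij).comp hφ hφ)
      (fun i => ?_) fun i => ?_
    · rw [integral_sub (hsi i) ((hvi i).const_mul m), integral_const_mul, hEs, hEv]; ring
    · rw [← hEv i]
      refine integral_mono_of_nonneg (Eventually.of_forall fun ω => sq_nonneg _) (hvi i)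
        (Eventually.of_forall fun ω => ?_)
      have h1 := hbd i ω
      have h2 := hv1 i ω
      have h3 := abs_nonneg (s i ω - m * v i ω)
      dsimp only
      rw [← sq_abs]
      nlinarith
  have hS' : ∫ ω, (∑ i, s i ω - m * ∑ i, v i ω) ^ 2 ∂μ ≤ P := by
    refine le_trans (le_of_eq ?_) hS
    congr with ω
    rw [Finset.sum_sub_distrib, Finset.mul_sum, mul_zero, sub_zero]
  have hmS : Measurable fun ω => ∑ i, s i ω := Finset.measurable_fun_sum _ fun i _ => hs i
  have hmV : Measurable fun ω => ∑ i, v i ω := Finset.measurable_fun_sum _ fun i _ => hv i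
  have hVn : ∀ ω, |∑ i, v i ω| ≤ n := fun ω => by
    rw [abs_of_nonneg (Finset.sum_nonneg fun i _ => (hs0 i ω).trans (hsv i ω))]
    exact (Finset.sum_le_sum fun i _ => hv1 i ω).trans (by simp)
  have hSn : ∀ ω, |∑ i, s i ω| ≤ n := fun ω => by
    rw [abs_of_nonneg (Finset.sum_nonneg fun i _ => hs0 i ω)]
    exact (Finset.sum_le_sum fun i _ => (hsv i ω).trans (hv1 i ω)).trans (by simp)
  have hVL : MemLp (fun ω => ∑ i, v i ω) 2 μ :=
    MemLp.of_bound hmV.aestronglyMeasurable n (Eventually.of_forall hVn)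
  have hSL : MemLp (fun ω => ∑ i, s i ω) 2 μ :=
    MemLp.of_bound hmS.aestronglyMeasurable n (Eventually.of_forall hSn)
  have hI1 : Integrable (fun ω => 4 / P ^ 2 * (∑ i, s i ω - m * ∑ i, v i ω) ^ 2) μ :=
    ((hSL.sub (hVL.const_mul m)).integrable_sq).const_mul _
  have hI2 : Integrable
      (fun ω => 4 * (|q| + 1) ^ 2 / P ^ 2 * (∑ i, v i ω - P) ^ 2) μ :=
    ((hVL.sub (memLp_const P)).integrable_sq).const_mul _
  calc _ ≤ ∫⁻ ω, ENNReal.ofReal (4 / P ^ 2 * (∑ i, s i ω - m * ∑ i, v i ω) ^ 2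
        + 4 * (|q| + 1) ^ 2 / P ^ 2 * (∑ i, v i ω - P) ^ 2) ∂μ := by
        refine lintegral_mono fun ω => ?_
        rw [← enorm_pow, Real.enorm_eq_ofReal (sq_nonneg _)]
        exact ENNReal.ofReal_le_ofReal (ratio_sub_sq_le hP
          (Finset.sum_nonneg fun i _ => hs0 i ω) (Finset.sum_le_sum fun i _ => hsv i ω) hm0 hm1)
    _ = ENNReal.ofReal (∫ ω, (4 / P ^ 2 * (∑ i, s i ω - m * ∑ i, v i ω) ^ 2
        + 4 * (|q| + 1) ^ 2 / P ^ 2 * (∑ i, v i ω - P) ^ 2) ∂μ) :=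
        (ofReal_integral_eq_lintegral_ofReal (hI1.add hI2)
          (Eventually.of_forall fun ω => add_nonneg
            (mul_nonneg (by positivity) (sq_nonneg _))
            (mul_nonneg (by positivity) (sq_nonneg _)))).symm
    _ ≤ _ := by
        refine ENNReal.ofReal_le_ofReal ?_
        rw [integral_add hI1 hI2, integral_const_mul, integral_const_mul]
        calc _ ≤ 4 / P ^ 2 * P + 4 * (|q| + 1) ^ 2 / P ^ 2 * P := by gcongr
          _ = _ := by field_simp

end Variance

/-! ### Regrouping independent variables -/

section Independence

variable {Ω α β γ δ : Type*} [MeasurableSpace Ω] [MeasurableSpace α] [MeasurableSpace β]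
  [MeasurableSpace γ] [MeasurableSpace δ] {μ : Measure Ω} [IsProbabilityMeasure μ]

/-- The hypotheses make the law of the triple a threefold product, which may be reassociated. -/
lemma indepFun_prodMk_right_of_prodMk_left {A : Ω → α} {B : Ω → β} {C : Ω → γ}
    (hA : Measurable A) (hB : Measurable B) (hC : Measurable C)
    (hAB : IndepFun A B μ) (hABC : IndepFun (fun ω => (A ω, B ω)) C μ) :
    IndepFun A (fun ω => (B ω, C ω)) μ := by
  have := Measure.isProbabilityMeasure_map (μ := μ) hA.aemeasurable
  have := Measure.isProbabilityMeasure_map (μ := μ) hB.aemeasurable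
  have := Measure.isProbabilityMeasure_map (μ := μ) hC.aemeasurable
  have hBC : IndepFun B C μ := hABC.comp measurable_snd measurable_id
  rw [indepFun_iff_map_prod_eq_prod_map_map (by fun_prop) (by fun_prop)] at *
  rw [hBC, ← Measure.prodAssoc_prod, ← hAB, ← hABC,
    Measure.map_map (MeasurableEquiv.measurable _) (by fun_prop)]
  rfl

/-- If `A, B` are independent, `C, D` are independent, and both pairs are independent, then
`(A, C)` and `(B, D)` are independent. -/
lemma indepFun_prodMk_prodMk_comm {A : Ω → α} {B : Ω → β} {C : Ω → γ} {D : Ω → δ}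
    (hA : Measurable A) (hB : Measurable B) (hC : Measurable C) (hD : Measurable D)
    (hAB : IndepFun A B μ) (hCD : IndepFun C D μ)
    (h : IndepFun (fun ω => (A ω, B ω)) (fun ω => (C ω, D ω)) μ) :
    IndepFun (fun ω => (A ω, C ω)) (fun ω => (B ω, D ω)) μ := by
  have h1 : IndepFun C (fun ω => (D ω, B ω)) μ :=
    indepFun_prodMk_right_of_prodMk_left hC hD hB hCD
      (h.symm.comp measurable_id measurable_snd)
  have h2 : IndepFun A (fun ω => (B ω, (C ω, D ω))) μ :=
    indepFun_prodMk_right_of_prodMk_left hA hB (hC.prodMk hD) hAB h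
  have h3 : IndepFun (fun ω => (D ω, B ω)) (fun ω => (C ω, A ω)) μ := by
    refine indepFun_prodMk_right_of_prodMk_left (hD.prodMk hB) hC hA h1.symm ?_
    have hφ : Measurable fun p : β × γ × δ => ((p.2.2, p.1), p.2.1) := by fun_prop
    exact (h2.comp measurable_id hφ).symm
  exact h3.symm.comp measurable_swap measurable_swap

/-- Tonelli for the product law. It serves to freeze the query `X`, and to freeze the datum of a
sensor while its coin is averaged. -/
lemma lintegral_comp_prodMk_of_indepFun {A : Ω → α} {B : Ω → β} (h : IndepFun A B μ)
    (hA : Measurable A) (hB : Measurable B) {φ : α × β → ENNReal} (hφ : Measurable φ) :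
    ∫⁻ ω, φ (A ω, B ω) ∂μ = ∫⁻ a, ∫⁻ ω, φ (a, B ω) ∂μ ∂μ.map A := by
  have := Measure.isProbabilityMeasure_map (μ := μ) hB.aemeasurable
  rw [← lintegral_map (f := φ) hφ (hA.prodMk hB),
    h.map_prod_eq_prod_map_map hA.aemeasurable hB.aemeasurable,
    lintegral_prod _ hφ.aemeasurable]
  refine lintegral_congr fun a => ?_
  rw [lintegral_map (f := fun b => φ (a, b)) (by fun_prop) hB]

end Independence

/-! ### The regression function minimises the risk -/

section Regression

variable {Ω E : Type*} [MeasurableSpace Ω] [MeasurableSpace E] {μ : Measure Ω}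
  [IsProbabilityMeasure μ]

/-- The regression function: a measurable version of `E[Y | X = x]`, and its optimality. -/
lemma exists_regression_function {X : Ω → E} {Y : Ω → ℝ} (hX : Measurable X)
    (hY2 : MemLp Y 2 μ) :
    ∃ η : E → ℝ, Measurable η ∧ MemLp (fun ω => η (X ω)) 2 μ ∧
      (∀ B, MeasurableSet B → ∫ ω in X ⁻¹' B, Y ω ∂μ = ∫ ω in X ⁻¹' B, η (X ω) ∂μ) ∧
      ∀ g : E → ℝ, Measurable g → Integrable (fun ω => |g (X ω) - Y ω| ^ 2) μ →
        ∫ ω, |η (X ω) - Y ω| ^ 2 ∂μ ≤ ∫ ω, |g (X ω) - Y ω| ^ 2 ∂μ := by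
  have hm : MeasurableSpace.comap X inferInstance ≤ (inferInstance : MeasurableSpace Ω) :=
    hX.comap_le
  have hYi : Integrable Y μ := hY2.integrable (by norm_num)
  obtain ⟨η, hη, hηX⟩ := (stronglyMeasurable_condExp (μ := μ) (f := Y)
    (m := MeasurableSpace.comap X inferInstance)).exists_eq_measurable_comp
  have hηX' : ∀ ω, η (X ω) = (μ[Y | MeasurableSpace.comap X inferInstance]) ω := fun ω => by
    rw [hηX]; rfl
  have hη2 : MemLp (fun ω => η (X ω)) 2 μ := by
    simp_rw [hηX']
    exact hY2.condExp (by norm_num)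
  refine ⟨η, hη.measurable, hη2, fun B hB => ?_, fun g hg hgi => ?_⟩
  · simp_rw [hηX']
    exact (setIntegral_condExp hm hYi ⟨B, hB, rfl⟩).symm
  · have hgX : Measurable fun ω => g (X ω) := hg.comp hX
    have hgY : MemLp (fun ω => g (X ω) - Y ω) 2 μ := by
      refine (memLp_two_iff_integrable_sq (hgX.aestronglyMeasurable.sub hY2.1)).2 ?_
      simpa only [sq_abs, Pi.sub_apply] using hgi
    have hg2 : MemLp (fun ω => g (X ω)) 2 μ := by
      refine (hgY.add hY2).congr_norm hgX.aestronglyMeasurable (Eventually.of_forall fun ω => ?_)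
      simp
    have hh2 : MemLp (fun ω => g (X ω) - η (X ω)) 2 μ := hg2.sub hη2
    have hhm : StronglyMeasurable[MeasurableSpace.comap X inferInstance]
        fun ω => g (X ω) - η (X ω) :=
      ((hg.sub hη.measurable).comp (comap_measurable X)).stronglyMeasurable
    have hηY : MemLp (fun ω => η (X ω) - Y ω) 2 μ := hη2.sub hY2
    have hpull := condExp_mul_of_stronglyMeasurable_left hhm (hh2.integrable_mul hY2) hYi
    -- Orthogonality: `g(X) - η(X)` is measurable with respect to `X`, so `Y` may be replaced by its
    -- conditional expectation.
    have h1 : ∫ ω, (g (X ω) - η (X ω)) * Y ω ∂μ = ∫ ω, (g (X ω) - η (X ω)) * η (X ω) ∂μ := by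
      have := integral_condExp (μ := μ) (f := (fun ω => g (X ω) - η (X ω)) * Y) hm
      rw [integral_congr_ae hpull] at this
      simp only [Pi.mul_apply, ← hηX'] at this
      exact this.symm
    have hI1 : Integrable (fun ω => (g (X ω) - η (X ω)) * Y ω) μ := hh2.integrable_mul hY2
    have hI2 : Integrable (fun ω => (g (X ω) - η (X ω)) * η (X ω)) μ := hh2.integrable_mul hη2
    have h2 : ∫ ω, 2 * ((g (X ω) - η (X ω)) * η (X ω) - (g (X ω) - η (X ω)) * Y ω) ∂μ = 0 := by
      rw [integral_const_mul, integral_sub hI2 hI1, h1]; simp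
    have hI3 : Integrable
        (fun ω => 2 * ((g (X ω) - η (X ω)) * η (X ω) - (g (X ω) - η (X ω)) * Y ω)) μ :=
      (hI2.sub hI1).const_mul 2
    have hI4 : Integrable (fun ω => |η (X ω) - Y ω| ^ 2) μ := by
      simpa only [sq_abs] using hηY.integrable_sq
    calc ∫ ω, |η (X ω) - Y ω| ^ 2 ∂μ
        = ∫ ω, (|η (X ω) - Y ω| ^ 2
          + 2 * ((g (X ω) - η (X ω)) * η (X ω) - (g (X ω) - η (X ω)) * Y ω)) ∂μ := by
          rw [integral_add hI4 hI3, h2, add_zero]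
      _ ≤ _ := by
          refine integral_mono (hI4.add hI3) hgi fun ω => ?_
          simp only [sq_abs]
          -- Pythagoras: the two integrands differ by exactly `(g(X) - η(X))²`.
          nlinarith [sq_nonneg (g (X ω) - η (X ω))]

end Regression

/-! ### Convergence of L² norms and truncation -/

section Convergence

lemma tendsto_eLpNorm_two_of_tendsto_sq {α : Type*} [MeasurableSpace α] {μ : Measure α}
    {f : ℕ → α → ℝ} (h : Tendsto (fun n => ∫⁻ x, ‖f n x‖ₑ ^ 2 ∂μ) atTop (𝓝 0)) :
    Tendsto (fun n => eLpNorm (f n) 2 μ) atTop (𝓝 0) := by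
  have h1 := h.ennrpow_const (1 / 2)
  rw [ENNReal.zero_rpow_of_pos (by norm_num)] at h1
  refine h1.congr fun n => ?_
  rw [← eLpNorm_two_sq, ← ENNReal.rpow_natCast_mul]
  norm_num

/-- The triangle inequality from both sides; finiteness of the norm of `g` makes truncated
subtraction in `ENNReal` continuous there. -/
lemma tendsto_eLpNorm_of_tendsto_eLpNorm_sub {α : Type*} [MeasurableSpace α] {μ : Measure α}
    {f : ℕ → α → ℝ} {g : α → ℝ} (hf : ∀ n, AEStronglyMeasurable (f n) μ) (hg : MemLp g 2 μ)
    (h : Tendsto (fun n => eLpNorm (f n - g) 2 μ) atTop (𝓝 0)) :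
    Tendsto (fun n => eLpNorm (f n) 2 μ) atTop (𝓝 (eLpNorm g 2 μ)) := by
  have hlow := ENNReal.Tendsto.sub (tendsto_const_nhds (x := eLpNorm g 2 μ)) h
    (Or.inl hg.eLpNorm_ne_top)
  have hup := (tendsto_const_nhds (x := eLpNorm g 2 μ)).add h
  rw [tsub_zero] at hlow
  rw [add_zero] at hup
  refine tendsto_of_tendsto_of_tendsto_of_le_of_le hlow hup (fun n => ?_) fun n => ?_
  · refine tsub_le_iff_right.2 ?_
    have := eLpNorm_sub_le (p := 2) (hf n) ((hf n).sub hg.1) (by norm_num)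
    rwa [sub_sub_cancel] at this
  · have := eLpNorm_add_le (p := 2) hg.1 ((hf n).sub hg.1) (by norm_num)
    rwa [add_sub_cancel] at this

lemma integral_abs_sq_eq_eLpNorm_sq {α : Type*} [MeasurableSpace α] {μ : Measure α}
    {f : α → ℝ} (hf : AEStronglyMeasurable f μ) :
    ∫ x, |f x| ^ 2 ∂μ = (eLpNorm f 2 μ ^ 2).toReal := by
  rw [eLpNorm_two_sq, integral_eq_lintegral_of_nonneg_ae
    (Eventually.of_forall fun x => by positivity) (by exact hf.norm.pow 2)]
  congr 1
  refine lintegral_congr fun x => ?_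
  rw [← enorm_pow, Real.enorm_eq_ofReal (sq_nonneg _), sq_abs]

/-- The truncation of `y` at level `c`. -/
noncomputable def truncateAbs (c y : ℝ) : ℝ := if |y| ≤ c then y else 0

lemma measurable_truncateAbs (c : ℝ) : Measurable (truncateAbs c) :=
  Measurable.ite (measurableSet_le measurable_id.abs measurable_const) measurable_id
    measurable_const

/-- Dominated convergence with dominating function `|f|²`: at each point the error is `0` or `-f`,
and it is `0` once `c n ≥ |f x|`. -/
lemma tendsto_eLpNorm_truncateAbs_sub {α : Type*} [MeasurableSpace α] {μ : Measure α}
    {f : α → ℝ} (hf : Measurable f) (hf2 : MemLp f 2 μ) {c : ℕ → ℝ} (hc : Tendsto c atTop atTop) :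
    Tendsto (fun n => eLpNorm ((fun x => truncateAbs (c n) (f x)) - f) 2 μ) atTop (𝓝 0) := by
  refine tendsto_eLpNorm_two_of_tendsto_sq ?_
  rw [← lintegral_zero (μ := μ)]
  refine tendsto_lintegral_of_dominated_convergence (fun x => ‖f x‖ₑ ^ 2) (fun n => ?_)
    (fun n => Eventually.of_forall fun x => ?_) ?_ (Eventually.of_forall fun x => ?_)
  · exact ((((measurable_truncateAbs _).comp hf).sub hf).enorm.pow_const 2)
  · simp only [Pi.sub_apply, truncateAbs]
    split_ifs <;> simp
  · rw [← eLpNorm_two_sq]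
    exact ENNReal.pow_ne_top hf2.eLpNorm_ne_top
  · refine tendsto_const_nhds.congr' ?_
    filter_upwards [hc.eventually_ge_atTop |f x|] with n hn
    simp [truncateAbs, hn]

end Convergence

/-! ### Votes, the estimate and its variance -/

section Network

variable {d : ℕ}

/-- The parameter of the coin of a voting sensor with label `y`. -/
noncomputable def coinParameter (c y : ℝ) : ℝ :=
  if |y| ≤ c then 1 / (2 * c) * y + 1 / 2 else 1 / 2

lemma measurable_coinParameter (c : ℝ) : Measurable (coinParameter c) :=
  Measurable.ite (measurableSet_le measurable_id.abs measurable_const) (by fun_prop)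
    measurable_const

lemma coinParameter_mem_Icc {c : ℝ} (hc : 0 < c) (y : ℝ) :
    coinParameter c y ∈ Set.Icc (0 : ℝ) 1 := by
  unfold coinParameter
  split_ifs with h
  · have h1 : |1 / (2 * c) * y| ≤ 1 / 2 := by
      rw [abs_mul, abs_of_pos (by positivity), one_div_mul_eq_div, div_le_div_iff₀ (by positivity)
        two_pos]
      linarith
    have := abs_le.1 h1
    constructor <;> linarith
  · norm_num

/-- The fusion rule inverts the encoding in expectation; a label out of range, sent as a fair coin,
decodes to `0`. -/
lemma two_mul_coinParameter_sub {c : ℝ} (hc : 0 < c) (y : ℝ) :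
    2 * c * (coinParameter c y - 1 / 2) = truncateAbs c y := by
  unfold coinParameter truncateAbs
  split_ifs
  · field_simp; ring
  · simp

lemma sensorResponse_eq_some_true_iff {c r : ℝ} {Z : ℝ → Bool} {xi : EuclideanSpace ℝ (Fin d)}
    {yi : ℝ} {x : EuclideanSpace ℝ (Fin d)} :
    sensorResponse c r Z xi yi x = some true ↔ dist xi x ≤ r ∧ Z (coinParameter c yi) = true := by
  unfold sensorResponse coinParameter
  rw [Metric.mem_closedBall, dist_comm]
  split_ifs <;> simp [*]

lemma sensorResponse_ne_none_iff {c r : ℝ} {Z : ℝ → Bool} {xi : EuclideanSpace ℝ (Fin d)}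
    {yi : ℝ} {x : EuclideanSpace ℝ (Fin d)} :
    sensorResponse c r Z xi yi x ≠ none ↔ dist xi x ≤ r := by
  unfold sensorResponse
  rw [Metric.mem_closedBall, dist_comm]
  split_ifs <;> simp [*]

section Votes

variable {T : Type*}

/-- Does the sensor with data `p.2.1` and private randomness `p.2.2` vote one at `p.1`? -/
noncomputable def oneVote (c r : ℝ) (z : ℝ → T → Bool)
    (p : EuclideanSpace ℝ (Fin d) × ((EuclideanSpace ℝ (Fin d) × ℝ) × T)) : ℝ :=
  if sensorResponse c r (fun θ => z θ p.2.2) p.2.1.1 p.2.1.2 p.1 = some true then 1 else 0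

/-- Does the sensor with data `p.2.1` and private randomness `p.2.2` vote at `p.1`? -/
noncomputable def anyVote (c r : ℝ) (z : ℝ → T → Bool)
    (p : EuclideanSpace ℝ (Fin d) × ((EuclideanSpace ℝ (Fin d) × ℝ) × T)) : ℝ :=
  if sensorResponse c r (fun θ => z θ p.2.2) p.2.1.1 p.2.1.2 p.1 ≠ none then 1 else 0

lemma measurable_anyVote [MeasurableSpace T] (c r : ℝ) (z : ℝ → T → Bool) :
    Measurable (anyVote (d := d) c r z) := by
  refine Measurable.ite ?_ measurable_const measurable_const
  simp_rw [sensorResponse_ne_none_iff]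
  exact measurableSet_le (by fun_prop) measurable_const

lemma measurable_oneVote [MeasurableSpace T] (c r : ℝ) {z : ℝ → T → Bool}
    (hz : Measurable fun p : ℝ × T => z p.1 p.2) : Measurable (oneVote (d := d) c r z) := by
  refine Measurable.ite ?_ measurable_const measurable_const
  simp_rw [sensorResponse_eq_some_true_iff]
  have h0 : MeasurableSet
      {p : EuclideanSpace ℝ (Fin d) × ((EuclideanSpace ℝ (Fin d) × ℝ) × T) |
        dist p.2.1.1 p.1 ≤ r} :=
    measurableSet_le (by fun_prop) measurable_const
  refine h0.inter ?_
  have h : Measurable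
      fun p : EuclideanSpace ℝ (Fin d) × ((EuclideanSpace ℝ (Fin d) × ℝ) × T) =>
        z (coinParameter c p.2.1.2) p.2.2 :=
    hz.comp (((measurable_coinParameter c).comp
      (measurable_snd.comp (measurable_fst.comp measurable_snd))).prodMk
        (measurable_snd.comp measurable_snd))
  exact h (measurableSet_singleton true)

lemma oneVote_nonneg (c r : ℝ) (z : ℝ → T → Bool)
    (p : EuclideanSpace ℝ (Fin d) × ((EuclideanSpace ℝ (Fin d) × ℝ) × T)) :
    0 ≤ oneVote c r z p := by
  unfold oneVote; split_ifs <;> norm_num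

lemma anyVote_le_one (c r : ℝ) (z : ℝ → T → Bool)
    (p : EuclideanSpace ℝ (Fin d) × ((EuclideanSpace ℝ (Fin d) × ℝ) × T)) :
    anyVote c r z p ≤ 1 := by
  unfold anyVote; split_ifs <;> norm_num

lemma oneVote_le_anyVote (c r : ℝ) (z : ℝ → T → Bool)
    (p : EuclideanSpace ℝ (Fin d) × ((EuclideanSpace ℝ (Fin d) × ℝ) × T)) :
    oneVote c r z p ≤ anyVote c r z p := by
  unfold oneVote anyVote
  split_ifs with h1 h2
  · exact le_rfl
  · simp [h1] at h2
  · exact zero_le_one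
  · exact le_rfl

end Votes

lemma abs_averageVote_le {n : ℕ} (q : ℝ) (δ : Fin n → Option Bool) :
    |averageVote q δ| ≤ |q| + 1 := by
  have h0 : 0 ≤ sumOfVotes δ := Finset.sum_nonneg fun i _ => by split_ifs <;> norm_num
  have h1 : sumOfVotes δ ≤ numberOfVotes δ := Finset.sum_le_sum fun i _ => by
    split_ifs with h2 h3
    · exact le_rfl
    · simp [h2] at h3
    · exact zero_le_one
    · exact le_rfl
  unfold averageVote
  split_ifs with h
  · linarith
  · have h2 : 0 ≤ sumOfVotes δ / numberOfVotes δ := div_nonneg h0 (h0.trans h1)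
    rw [abs_of_nonneg h2]
    have := div_le_one_of_le₀ h1 (h0.trans h1)
    linarith [abs_nonneg q]

/-- Valid for either sign of `c`, which gives integrability for every `n` and not only for large
`n`. -/
lemma abs_fusionRule_le {n : ℕ} (c q : ℝ) (δ : Fin n → Option Bool) :
    |fusionRule c q δ| ≤ 2 * |c| * (|q| + 2) := by
  unfold fusionRule
  rw [abs_mul, abs_mul, abs_two]
  gcongr
  have h1 := abs_sub (averageVote q δ) (1 / 2)
  have h2 := abs_averageVote_le q δ
  have h3 : |(1 / 2 : ℝ)| = 1 / 2 := abs_of_pos (by norm_num)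
  linarith

/-- The estimate as a function of the query, the training data and the private randomness. -/
noncomputable def estimateOf {S : ℕ → Type*} (c r q : ℝ) (z : (i : ℕ) → ℝ → S i → Bool) (n : ℕ)
    (p : EuclideanSpace ℝ (Fin d) × ((ℕ → EuclideanSpace ℝ (Fin d) × ℝ) × ((i : ℕ) → S i))) : ℝ :=
  fusionRule c q fun i : Fin n =>
    sensorResponse c r (fun θ => z i θ (p.2.2 i)) (p.2.1 i).1 (p.2.1 i).2 p.1

lemma estimateOf_eq {S : ℕ → Type*} (c r q : ℝ) (z : (i : ℕ) → ℝ → S i → Bool) (n : ℕ)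
    (p : EuclideanSpace ℝ (Fin d) × ((ℕ → EuclideanSpace ℝ (Fin d) × ℝ) × ((i : ℕ) → S i))) :
    estimateOf c r q z n p = 2 * c *
      ((if ∑ i : Fin n, anyVote c r (z i) (p.1, (p.2.1 i, p.2.2 i)) = 0 then q else
        (∑ i : Fin n, oneVote c r (z i) (p.1, (p.2.1 i, p.2.2 i))) /
          ∑ i : Fin n, anyVote c r (z i) (p.1, (p.2.1 i, p.2.2 i))) - 1 / 2) := by
  rfl

lemma measurable_estimateOf {S : ℕ → Type*} [∀ i, MeasurableSpace (S i)] (c r q : ℝ)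
    {z : (i : ℕ) → ℝ → S i → Bool} (hz : ∀ i, Measurable fun p : ℝ × S i => z i p.1 p.2) (n : ℕ) :
    Measurable (estimateOf (d := d) c r q z n) := by
  rw [show estimateOf (d := d) c r q z n = _ from funext (estimateOf_eq c r q z n)]
  have hany : Measurable fun p : EuclideanSpace ℝ (Fin d) ×
      ((ℕ → EuclideanSpace ℝ (Fin d) × ℝ) × ((i : ℕ) → S i)) =>
      ∑ i : Fin n, anyVote c r (z i) (p.1, (p.2.1 i, p.2.2 i)) :=
    Finset.measurable_fun_sum _ fun i _ => (measurable_anyVote c r (z i)).comp (by fun_prop)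
  have hone : Measurable fun p : EuclideanSpace ℝ (Fin d) ×
      ((ℕ → EuclideanSpace ℝ (Fin d) × ℝ) × ((i : ℕ) → S i)) =>
      ∑ i : Fin n, oneVote c r (z i) (p.1, (p.2.1 i, p.2.2 i)) :=
    Finset.measurable_fun_sum _ fun i _ => (measurable_oneVote c r (hz i)).comp (by fun_prop)
  exact ((Measurable.ite (hany (measurableSet_singleton 0)) measurable_const
    (hone.div hany)).sub_const _).const_mul _

section Sensor

variable {T Ω : Type*} [MeasurableSpace Ω] {μ : Measure Ω}

lemma integral_anyVote {D : Ω → EuclideanSpace ℝ (Fin d) × ℝ} (hD : Measurable D) (ξ : Ω → T)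
    (z : ℝ → T → Bool) (c r : ℝ) (x : EuclideanSpace ℝ (Fin d)) :
    ∫ ω, anyVote c r z (x, (D ω, ξ ω)) ∂μ
      = (μ.map D).real (Prod.fst ⁻¹' Metric.closedBall x r) := by
  have hS : MeasurableSet
      (Prod.fst ⁻¹' Metric.closedBall x r : Set (EuclideanSpace ℝ (Fin d) × ℝ)) :=
    measurable_fst Metric.isClosed_closedBall.measurableSet
  rw [map_measureReal_apply hD hS, ← integral_indicator_one (hD hS)]
  congr with ω
  simp only [anyVote, sensorResponse_ne_none_iff]
  by_cases h : dist (D ω).1 x ≤ r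
  · rw [if_pos h, Set.indicator_of_mem (by exact h), Pi.one_apply]
  · rw [if_neg h, Set.indicator_of_notMem (by exact h)]

/-- Given the datum, independence leaves a coin with a frozen parameter, which lies in `[0, 1]`
because `c > 0`. -/
lemma integral_oneVote [MeasurableSpace T] [IsProbabilityMeasure μ]
    {D : Ω → EuclideanSpace ℝ (Fin d) × ℝ} (hD : Measurable D) {ξ : Ω → T}
    (hξ : Measurable ξ) {z : ℝ → T → Bool} (hz : Measurable fun p : ℝ × T => z p.1 p.2)
    (hBernoulli : ∀ θ ∈ Set.Icc (0 : ℝ) 1, μ {ω | z θ (ξ ω) = true} = ENNReal.ofReal θ)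
    (hind : IndepFun D ξ μ) {c : ℝ} (hc : 0 < c) (r : ℝ) (x : EuclideanSpace ℝ (Fin d)) :
    ∫ ω, oneVote c r z (x, (D ω, ξ ω)) ∂μ
      = ∫ y in Prod.fst ⁻¹' Metric.closedBall x r, coinParameter c y.2 ∂μ.map D := by
  have hS : MeasurableSet
      (Prod.fst ⁻¹' Metric.closedBall x r : Set (EuclideanSpace ℝ (Fin d) × ℝ)) :=
    measurable_fst Metric.isClosed_closedBall.measurableSet
  have hm : Measurable fun p : (EuclideanSpace ℝ (Fin d) × ℝ) × T => oneVote c r z (x, p) :=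
    (measurable_oneVote c r hz).comp measurable_prodMk_left
  have hθ : Measurable fun y : EuclideanSpace ℝ (Fin d) × ℝ => coinParameter c y.2 :=
    (measurable_coinParameter c).comp measurable_snd
  rw [integral_eq_lintegral_of_nonneg_ae (Eventually.of_forall fun ω => oneVote_nonneg _ _ _ _)
      (hm.comp (hD.prodMk hξ)).aestronglyMeasurable,
    integral_eq_lintegral_of_nonneg_ae (f := fun y => coinParameter c (Prod.snd y))
      (Eventually.of_forall fun y => (coinParameter_mem_Icc hc y.2).1) hθ.aestronglyMeasurable,
    lintegral_comp_prodMk_of_indepFun hind hD hξ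
      (φ := fun p => ENNReal.ofReal (oneVote c r z (x, p))) hm.ennreal_ofReal,
    ← lintegral_indicator hS]
  congr 1
  refine lintegral_congr fun y => ?_
  by_cases hy : dist y.1 x ≤ r
  · rw [Set.indicator_of_mem (by exact hy), ← hBernoulli _ (coinParameter_mem_Icc hc y.2)]
    have hB : MeasurableSet {ω | z (coinParameter c y.2) (ξ ω) = true} := by
      have : Measurable fun ω => z (coinParameter c y.2) (ξ ω) :=
        hz.comp (measurable_const.prodMk hξ)
      exact this (measurableSet_singleton true)
    rw [← lintegral_indicator_one hB]
    refine lintegral_congr fun ω => ?_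
    simp only [oneVote, sensorResponse_eq_some_true_iff, hy, true_and, Set.indicator_apply]
    split_ifs with h1 h2 h2 <;> simp_all
  · rw [Set.indicator_of_notMem (by exact hy)]
    simp [oneVote, sensorResponse_eq_some_true_iff, hy]

/-- Mean squared deviation of the estimate at `x` from the local average of truncated labels. -/
lemma lintegral_estimateOf_sub_sq_le [IsProbabilityMeasure μ] {S : ℕ → Type*}
    [∀ i, MeasurableSpace (S i)]
    {ν : Measure (EuclideanSpace ℝ (Fin d) × ℝ)} [IsProbabilityMeasure ν]
    {D : ℕ → Ω → EuclideanSpace ℝ (Fin d) × ℝ} {ξ : (i : ℕ) → Ω → S i}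
    {z : (i : ℕ) → ℝ → S i → Bool} (hD : ∀ i, Measurable (D i)) (hξ : ∀ i, Measurable (ξ i))
    (hz : ∀ i, Measurable fun p : ℝ × S i => z i p.1 p.2)
    (hBernoulli : ∀ i, ∀ θ ∈ Set.Icc (0 : ℝ) 1,
      μ {ω | z i θ (ξ i ω) = true} = ENNReal.ofReal θ)
    (hν : ∀ i, μ.map (D i) = ν) (hDξ : ∀ i, IndepFun (D i) (ξ i) μ)
    (hind : Pairwise fun i j => IndepFun (fun ω => (D i ω, ξ i ω)) (fun ω => (D j ω, ξ j ω)) μ)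
    {c : ℝ} (hc : 0 < c) (r q : ℝ) {n : ℕ} (hn : n ≠ 0) (x : EuclideanSpace ℝ (Fin d)) :
    ∫⁻ ω, ‖estimateOf c r q z n (x, ((fun i => D i ω), fun i => ξ i ω))
        - localAverage ν r (fun y => truncateAbs c y.2) x‖ₑ ^ 2 ∂μ
      ≤ ENNReal.ofReal (4 * (4 + 4 * (|q| + 1) ^ 2) * (c ^ 2 / n))
        * (ν.fst (Metric.closedBall x r))⁻¹ := by
  rw [← fst_closedBall]
  set B : Set (EuclideanSpace ℝ (Fin d) × ℝ) := Prod.fst ⁻¹' Metric.closedBall x r with hBdef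
  -- On a null window the right side is `⊤`, since its constant factor is positive.
  rcases eq_or_ne (ν B) 0 with h0 | h0
  · rw [h0, ENNReal.inv_zero, ENNReal.mul_top]
    · exact le_top
    · rw [ENNReal.ofReal_ne_zero_iff]; positivity
  have hp : 0 < ν.real B := ENNReal.toReal_pos h0 (measure_ne_top _ _)
  have hθ : Measurable fun y : EuclideanSpace ℝ (Fin d) × ℝ => coinParameter c y.2 :=
    (measurable_coinParameter c).comp measurable_snd
  have hθi : Integrable (fun y : EuclideanSpace ℝ (Fin d) × ℝ => coinParameter c y.2) ν :=
    Integrable.of_bound hθ.aestronglyMeasurable 1 (Eventually.of_forall fun y => by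
      have := coinParameter_mem_Icc hc y.2
      rw [Real.norm_eq_abs, abs_of_nonneg this.1]
      exact this.2)
  -- `m` is the probability that a sensor sends a one given that it votes, hence the target of the
  -- average vote.
  set m := localAverage ν r (fun y => coinParameter c y.2) x with hm
  have hmB : m ∈ Set.Icc (0 : ℝ) 1 :=
    (convex_Icc 0 1).set_average_mem isClosed_Icc h0 (measure_ne_top _ _)
      (Eventually.of_forall fun y => coinParameter_mem_Icc hc y.2) hθi.integrableOn
  have hmt : localAverage ν r (fun y => truncateAbs c y.2) x = 2 * c * (m - 1 / 2) := by
    simp_rw [← two_mul_coinParameter_sub hc]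
    rw [hm, localAverage, localAverage, setAverage_eq, setAverage_eq, integral_const_mul,
      integral_sub hθi.integrableOn (integrable_const _), setIntegral_const]
    simp only [smul_eq_mul, ← hBdef]
    field_simp
  have hEs (i : ℕ) : ∫ ω, oneVote c r (z i) (x, (D i ω, ξ i ω)) ∂μ = ν.real B * m := by
    rw [integral_oneVote (hD i) (hξ i) (hz i) (hBernoulli i) (hDξ i) hc, hν, hm, localAverage,
      setAverage_eq, smul_eq_mul, mul_inv_cancel_left₀ hp.ne']
  have hEv (i : ℕ) : ∫ ω, anyVote c r (z i) (x, (D i ω, ξ i ω)) ∂μ = ν.real B := by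
    rw [integral_anyVote (hD i), hν]
  have hmeas1 (i : ℕ) : Measurable fun p => oneVote c r (z i) (x, p) :=
    (measurable_oneVote c r (hz i)).comp measurable_prodMk_left
  have hmeas2 (i : ℕ) : Measurable fun p => anyVote c r (z i) (x, p) :=
    (measurable_anyVote c r (z i)).comp measurable_prodMk_left
  have hDξm (i : ℕ) : Measurable fun ω => (D i ω, ξ i ω) := (hD i).prodMk (hξ i)
  have key := lintegral_ratio_sub_sq_le (μ := μ) hn
    (s := fun i ω => oneVote c r (z i) (x, (D i ω, ξ i ω)))
    (v := fun i ω => anyVote c r (z i) (x, (D i ω, ξ i ω)))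
    (fun i => (hmeas1 i).comp (hDξm i)) (fun i => (hmeas2 i).comp (hDξm i))
    (fun i ω => oneVote_nonneg _ _ _ _) (fun i ω => oneVote_le_anyVote _ _ _ _)
    (fun i ω => anyVote_le_one _ _ _ _)
    (fun i j hij => (hind (Fin.val_injective.ne hij)).comp
      ((hmeas1 i).prodMk (hmeas2 i)) ((hmeas1 j).prodMk (hmeas2 j)))
    hp hmB.1 hmB.2 (fun i => hEv i) (fun i => hEs i) q
  have hfactor (ω : Ω) :
      ‖estimateOf c r q z n (x, ((fun i => D i ω), fun i => ξ i ω)) - 2 * c * (m - 1 / 2)‖ₑ ^ 2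
      = ENNReal.ofReal (4 * c ^ 2) *
        ‖(if ∑ i : Fin n, anyVote c r (z i) (x, (D i ω, ξ i ω)) = 0 then q else
          (∑ i : Fin n, oneVote c r (z i) (x, (D i ω, ξ i ω))) /
            ∑ i : Fin n, anyVote c r (z i) (x, (D i ω, ξ i ω))) - m‖ₑ ^ 2 := by
    rw [estimateOf_eq, ← mul_sub, sub_sub_sub_cancel_right, enorm_mul, mul_pow, ← enorm_pow (2 * c),
      Real.enorm_eq_ofReal (sq_nonneg _)]
    congr 2
    ring
  rw [hmt]
  simp_rw [hfactor]
  rw [lintegral_const_mul' _ _ ENNReal.ofReal_ne_top]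
  refine (mul_le_mul_right key _).trans (le_of_eq ?_)
  rw [← ENNReal.ofReal_mul (by positivity), ← ofReal_measureReal (μ := ν) (s := B),
    ← ENNReal.ofReal_inv_of_pos hp, ← ENNReal.ofReal_mul (by positivity)]
  congr 1
  field_simp

end Sensor

end Network

/-! ### Assembling variance, bias and minimal risk -/

lemma minimalRisk_eq {Ω : Type*} [MeasurableSpace Ω] {μ : Measure Ω} {d : ℕ}
    {X : Ω → EuclideanSpace ℝ (Fin d)} {Y : Ω → ℝ} {η : EuclideanSpace ℝ (Fin d) → ℝ}
    (hη : Measurable η) (hηi : Integrable (fun ω => |η (X ω) - Y ω| ^ 2) μ)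
    (hmin : ∀ g : EuclideanSpace ℝ (Fin d) → ℝ, Measurable g →
      Integrable (fun ω => |g (X ω) - Y ω| ^ 2) μ →
        ∫ ω, |η (X ω) - Y ω| ^ 2 ∂μ ≤ ∫ ω, |g (X ω) - Y ω| ^ 2 ∂μ) :
    minimalRisk μ X Y = ∫ ω, |η (X ω) - Y ω| ^ 2 ∂μ := by
  refine IsLeast.csInf_eq ⟨⟨η, hη, hηi, rfl⟩, ?_⟩
  rintro _ ⟨g, hg, hgi, rfl⟩
  exact hmin g hg hgi

/-- The variance part of the error of the network estimate tends to zero in `L²`. -/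
lemma tendsto_eLpNorm_estimateOf_sub_localAverage {Ω : Type*} [MeasurableSpace Ω] {μ : Measure Ω}
    [IsProbabilityMeasure μ] {d : ℕ} {X : Ω → EuclideanSpace ℝ (Fin d)} {S : ℕ → Type*}
    [∀ i, MeasurableSpace (S i)]
    {ν : Measure (EuclideanSpace ℝ (Fin d) × ℝ)} [IsProbabilityMeasure ν]
    {D : ℕ → Ω → EuclideanSpace ℝ (Fin d) × ℝ} {ξ : (i : ℕ) → Ω → S i}
    {z : (i : ℕ) → ℝ → S i → Bool} (hX : Measurable X) (hD : ∀ i, Measurable (D i))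
    (hξ : ∀ i, Measurable (ξ i)) (hz : ∀ i, Measurable fun p : ℝ × S i => z i p.1 p.2)
    (hBernoulli : ∀ i, ∀ θ ∈ Set.Icc (0 : ℝ) 1,
      μ {ω | z i θ (ξ i ω) = true} = ENNReal.ofReal θ)
    (hν : ∀ i, μ.map (D i) = ν) (hXν : μ.map X = ν.fst) (hDξ : ∀ i, IndepFun (D i) (ξ i) μ)
    (hind : Pairwise fun i j => IndepFun (fun ω => (D i ω, ξ i ω)) (fun ω => (D j ω, ξ j ω)) μ)
    (hXDξ : IndepFun X (fun ω => ((fun i => D i ω), fun i => ξ i ω)) μ)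
    (hbdd : ∃ R : ℝ, 0 ≤ R ∧ ∀ᵐ x ∂ν.fst, x ∈ Metric.closedBall 0 R) {c r : ℕ → ℝ} (q : ℝ)
    (hrpos : ∀ᶠ n in atTop, 0 < r n) (hc : Tendsto c atTop atTop) (hr : Tendsto r atTop (𝓝 0))
    (hcr : Tendsto (fun n : ℕ => c n ^ 2 / (n * r n ^ d)) atTop (𝓝 0)) :
    Tendsto (fun n => eLpNorm (fun ω =>
      estimateOf (c n) (r n) q z n (X ω, ((fun i => D i ω), fun i => ξ i ω))
        - localAverage ν (r n) (fun y => truncateAbs (c n) y.2) (X ω)) 2 μ) atTop (𝓝 0) := by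
  obtain ⟨R, hR, hRν⟩ := hbdd
  refine tendsto_eLpNorm_two_of_tendsto_sq ?_
  set A : ℝ := 4 * (4 + 4 * (|q| + 1) ^ 2) * (2 * R * (d + 1) + 2) ^ d with hA
  have hlim : Tendsto (fun n : ℕ => ENNReal.ofReal (A * (c n ^ 2 / (n * r n ^ d)))) atTop
      (𝓝 0) := by
    simpa using ENNReal.tendsto_ofReal (hcr.const_mul A)
  refine tendsto_of_tendsto_of_tendsto_of_le_of_le' tendsto_const_nhds hlim
    (Eventually.of_forall fun _ => zero_le) ?_
  filter_upwards [hrpos, hc.eventually_gt_atTop 0, hr.eventually (gt_mem_nhds one_pos),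
    eventually_ne_atTop 0] with n hrn hcn hrn1 hn
  have hW : Measurable fun ω => ((fun i => D i ω), fun i => ξ i ω) :=
    (measurable_pi_lambda _ hD).prodMk (measurable_pi_lambda _ hξ)
  have hm : Measurable (localAverage ν (r n) (fun y => truncateAbs (c n) y.2)) :=
    measurable_localAverage ((measurable_truncateAbs _).comp measurable_snd) _
  -- The query is independent of data and coins together, so the pointwise variance bound applies at
  -- each `x` and is then integrated over the law of `X`.
  calc _ = ∫⁻ x, ∫⁻ ω, ‖estimateOf (c n) (r n) q z n (x, ((fun i => D i ω), fun i => ξ i ω))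
        - localAverage ν (r n) (fun y => truncateAbs (c n) y.2) x‖ₑ ^ 2 ∂μ ∂μ.map X :=
        lintegral_comp_prodMk_of_indepFun hXDξ hX hW
          (φ := fun p => ‖estimateOf (c n) (r n) q z n p
            - localAverage ν (r n) (fun y => truncateAbs (c n) y.2) p.1‖ₑ ^ 2)
          (((measurable_estimateOf _ _ _ hz n).sub (hm.comp measurable_fst)).enorm.pow_const 2)
    _ ≤ ∫⁻ x, ENNReal.ofReal (4 * (4 + 4 * (|q| + 1) ^ 2) * (c n ^ 2 / n))
        * (ν.fst (Metric.closedBall x (r n)))⁻¹ ∂ν.fst := by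
        rw [hXν]
        exact lintegral_mono fun x =>
          lintegral_estimateOf_sub_sq_le hD hξ hz hBernoulli hν hDξ hind hcn (r n) q hn x
    _ ≤ ENNReal.ofReal (4 * (4 + 4 * (|q| + 1) ^ 2) * (c n ^ 2 / n))
        * ENNReal.ofReal ((2 * R * (d + 1) + 2) ^ d / r n ^ d) := by
        rw [lintegral_const_mul' _ _ ENNReal.ofReal_ne_top]
        gcongr
        exact lintegral_inv_measure_closedBall_le ν.fst hrn hrn1.le hR hRν
    _ = ENNReal.ofReal (A * (c n ^ 2 / (n * r n ^ d))) := by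
        rw [← ENNReal.ofReal_mul (by positivity)]
        congr 1
        rw [hA]
        field_simp

/-- The coin `Z_{i,θ}` of sensor `i` is `z i θ (ξ i)`, a jointly measurable function of the parameter
`θ` and of the private randomness `ξ i` of the sensor. -/
theorem proposition2 {Ω : Type*} [MeasurableSpace Ω] (μ : Measure Ω) [IsProbabilityMeasure μ]
    {d : ℕ}
    (X : Ω → EuclideanSpace ℝ (Fin d)) (Y : Ω → ℝ)
    (Xs : ℕ → Ω → EuclideanSpace ℝ (Fin d)) (Ys : ℕ → Ω → ℝ)
    {S : ℕ → Type*} [∀ i, MeasurableSpace (S i)]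
    (ξ : (i : ℕ) → Ω → S i) (z : (i : ℕ) → ℝ → S i → Bool)
    (c r : ℕ → ℝ) (q : ℝ)
    -- everything is measurable
    (hX : Measurable X) (hY : Measurable Y)
    (hXs : ∀ i, Measurable (Xs i)) (hYs : ∀ i, Measurable (Ys i))
    (hξ : ∀ i, Measurable (ξ i))
    (hz : ∀ i, Measurable (fun p : ℝ × S i => z i p.1 p.2))
    -- for each `θ` in `[0,1]`, the coin `Z_{i,θ}` is Bernoulli with parameter `θ`
    (hBernoulli : ∀ i, ∀ θ ∈ Set.Icc (0 : ℝ) 1,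
      μ {ω | z i θ (ξ i ω) = true} = ENNReal.ofReal θ)
    -- the training data are distributed as `(X, Y)`
    (hident : ∀ i, IdentDistrib (fun ω => (Xs i ω, Ys i ω)) (fun ω => (X ω, Y ω)) μ μ)
    -- the new observation, the training data and the private randomness of the sensors are
    -- mutually independent
    (hindepData : iIndepFun (fun i ω => (Xs i ω, Ys i ω)) μ)
    (hindepNew : IndepFun (fun ω => (X ω, Y ω)) (fun ω (i : ℕ) => (Xs i ω, Ys i ω)) μ)
    (hindepCoins : iIndepFun ξ μ)
    (hindepCoinsData : IndepFun (fun ω => ((X ω, Y ω), fun i : ℕ => (Xs i ω, Ys i ω)))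
      (fun ω (i : ℕ) => ξ i ω) μ)
    -- the assumptions on the distribution of `(X, Y)`
    (hcompact : ∃ K : Set (EuclideanSpace ℝ (Fin d)), IsCompact K ∧ ∀ᵐ ω ∂μ, X ω ∈ K)
    (hY2 : Integrable (fun ω => Y ω ^ 2) μ)
    -- the assumptions on the sequences
    (hrpos : ∀ᶠ n in atTop, 0 < r n)
    (hc : Tendsto c atTop atTop)
    (hr : Tendsto r atTop (𝓝 0))
    (hcr : Tendsto (fun n : ℕ => c n ^ 2 / (n * r n ^ d)) atTop (𝓝 0)) :
    (∀ n, Integrable (fun ω =>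
      |networkEstimate c r q Xs Ys (fun i θ ω => z i θ (ξ i ω)) n (X ω) ω - Y ω| ^ 2) μ) ∧
    Tendsto (fun n => ∫ ω,
      conditionalRisk μ c r q X Y Xs Ys (fun i θ ω => z i θ (ξ i ω)) n ω ∂μ)
      atTop (𝓝 (minimalRisk μ X Y)) := by

  have hXY : Measurable fun ω => (X ω, Y ω) := hX.prodMk hY
  have hD : ∀ i, Measurable fun ω => (Xs i ω, Ys i ω) := fun i => (hXs i).prodMk (hYs i)
  have hDall : Measurable fun ω (i : ℕ) => (Xs i ω, Ys i ω) := measurable_pi_lambda _ hD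
  have hξall : Measurable fun ω (i : ℕ) => ξ i ω := measurable_pi_lambda _ hξ
  have hY2L : MemLp Y 2 μ := (memLp_two_iff_integrable_sq hY.aestronglyMeasurable).2 hY2
  set ν : Measure (EuclideanSpace ℝ (Fin d) × ℝ) := μ.map fun ω => (X ω, Y ω) with hνdef
  have : IsProbabilityMeasure ν := Measure.isProbabilityMeasure_map hXY.aemeasurable
  have hXν : μ.map X = ν.fst := by
    rw [Measure.fst, hνdef, Measure.map_map measurable_fst hXY]; rfl
  set est : ℕ → Ω → ℝ := fun n ω =>
    networkEstimate c r q Xs Ys (fun i θ ω => z i θ (ξ i ω)) n (X ω) ω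
  have hest_eq : ∀ n, est n = fun ω => estimateOf (c n) (r n) q z n
    (X ω, ((fun i => (Xs i ω, Ys i ω)), fun i => ξ i ω)) := fun n => rfl
  have hestm : ∀ n, Measurable (est n) := fun n => by
    rw [hest_eq]
    exact (measurable_estimateOf (c n) (r n) q hz n).comp (hX.prodMk (hDall.prodMk hξall))
  have hest2 : ∀ n, MemLp (est n) 2 μ := fun n =>
    MemLp.of_bound (hestm n).aestronglyMeasurable (2 * |c n| * (|q| + 2))
      (Eventually.of_forall fun ω => abs_fusionRule_le _ _ _)
  have hint : ∀ n, Integrable (fun ω => |est n ω - Y ω| ^ 2) μ := fun n => by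
    simpa only [sq_abs, Pi.sub_apply] using ((hest2 n).sub hY2L).integrable_sq
  refine ⟨hint, ?_⟩
  obtain ⟨η, hη, hη2, hηset, hηmin⟩ := exists_regression_function hX hY2L
  have hηY : MemLp (fun ω => η (X ω) - Y ω) 2 μ := hη2.sub hY2L
  have hηi : Integrable (fun ω => |η (X ω) - Y ω| ^ 2) μ := by
    simpa only [sq_abs] using hηY.integrable_sq
  have hvar : Tendsto (fun n => eLpNorm (fun ω =>
      est n ω - localAverage ν (r n) (fun y => truncateAbs (c n) y.2) (X ω)) 2 μ)
      atTop (𝓝 0) := by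
    refine tendsto_eLpNorm_estimateOf_sub_localAverage hX hD hξ hz hBernoulli
      (fun i => (hident i).map_eq) hXν ?_ ?_ ?_ ?_ q hrpos hc hr hcr
    · intro i
      exact hindepCoinsData.comp ((measurable_pi_apply i).comp measurable_snd)
        (measurable_pi_apply i)
    · intro i j hij
      refine indepFun_prodMk_prodMk_comm (hD i) (hD j) (hξ i) (hξ j)
        (hindepData.indepFun hij) (hindepCoins.indepFun hij) ?_
      exact hindepCoinsData.comp (((measurable_pi_apply i).comp measurable_snd).prodMk
        ((measurable_pi_apply j).comp measurable_snd))
        ((measurable_pi_apply i).prodMk (measurable_pi_apply j))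
    -- The new pair is independent of the data, and the coins of both; so it is independent of data
    -- and coins jointly.
    · exact (indepFun_prodMk_right_of_prodMk_left hXY hDall hξall hindepNew
        hindepCoinsData).comp measurable_fst measurable_id
    · obtain ⟨K, hK, hXK⟩ := hcompact
      obtain ⟨R, hR⟩ := hK.isBounded.subset_closedBall 0
      refine ⟨max R 0, le_max_right _ _, ?_⟩
      rw [← hXν]
      refine (ae_map_iff hX.aemeasurable Metric.isClosed_closedBall.measurableSet).2 ?_
      filter_upwards [hXK] with ω hω
      exact Metric.closedBall_subset_closedBall (le_max_left _ _) (hR hω)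
  have htm : ∀ n, Measurable fun y : EuclideanSpace ℝ (Fin d) × ℝ => truncateAbs (c n) y.2 :=
    fun n => (measurable_truncateAbs _).comp measurable_snd
  have hsnd2 : MemLp (fun y : EuclideanSpace ℝ (Fin d) × ℝ => y.2) 2 ν :=
    (memLp_map_measure_iff measurable_snd.aestronglyMeasurable hXY.aemeasurable).2 hY2L
  have hbias : Tendsto (fun n => eLpNorm (fun ω =>
      localAverage ν (r n) (fun y => truncateAbs (c n) y.2) (X ω) - η (X ω)) 2 μ)
      atTop (𝓝 0) := by
    have h := tendsto_eLpNorm_localAverage_seq_sub (ν := ν) hη ?_ measurable_snd hsnd2 ?_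
      htm (fun n => ?_) (tendsto_eLpNorm_truncateAbs_sub measurable_snd hsnd2 hc) hrpos hr
    · refine h.congr fun n => ?_
      rw [← hXν]
      exact eLpNorm_map_measure
        ((measurable_localAverage (htm n) _).sub hη).aestronglyMeasurable hX.aemeasurable
    · rw [← hXν]
      exact (memLp_map_measure_iff hη.aestronglyMeasurable hX.aemeasurable).2 hη2
    · intro B hB
      rw [hνdef, setIntegral_map (measurable_fst hB) measurable_snd.aestronglyMeasurable
          hXY.aemeasurable,
        setIntegral_map (f := fun z => η z.1) (measurable_fst hB)
          (hη.comp measurable_fst).aestronglyMeasurable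
          hXY.aemeasurable]
      exact hηset B hB
    · refine hsnd2.mono (htm n).aestronglyMeasurable (Eventually.of_forall fun y => ?_)
      unfold truncateAbs
      split_ifs <;> simp
  -- `Y` cancels, leaving the sum of the variance part and the bias part.
  have hdiff : Tendsto (fun n => eLpNorm ((fun ω => est n ω - Y ω) - fun ω => η (X ω) - Y ω) 2 μ)
      atTop (𝓝 0) := by
    have h0 := hvar.add hbias
    rw [add_zero] at h0
    refine tendsto_of_tendsto_of_tendsto_of_le_of_le tendsto_const_nhds h0
      (fun _ => zero_le) fun n => ?_
    have hm := (measurable_localAverage (ν := ν) (htm n) (r n)).comp hX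
    have := eLpNorm_add_le (p := 2) (μ := μ) ((hestm n).sub hm).aestronglyMeasurable
      (hm.sub (hη.comp hX)).aestronglyMeasurable (by norm_num)
    refine le_trans (le_of_eq ?_) this
    congr 1
    funext ω
    simp only [Pi.add_apply, Pi.sub_apply, Function.comp_apply]
    ring
  have hnorm := tendsto_eLpNorm_of_tendsto_eLpNorm_sub
    (fun n => ((hestm n).sub hY).aestronglyMeasurable) hηY hdiff
  rw [minimalRisk_eq hη hηi hηmin, integral_abs_sq_eq_eLpNorm_sq hηY.1]
  have hsq := (ENNReal.tendsto_toReal (ENNReal.pow_ne_top (n := 2) hηY.eLpNorm_ne_top)).comp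
    (ENNReal.Tendsto.pow (n := 2) hnorm)
  refine hsq.congr fun n => ?_
  have hle : trainingSigma Xs Ys n ≤ (inferInstance : MeasurableSpace Ω) :=
    (measurable_pi_lambda _ fun i : Fin n => hD i).comap_le
  -- By the tower property the mean of the conditional risk is the unconditional one, a squared L²
  -- norm.
  rw [conditionalRisk, integral_condExp hle]
  exact (integral_abs_sq_eq_eLpNorm_sq ((hestm n).sub hY).aestronglyMeasurable).symm
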